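/- Let $\Sigma$ be an alphabet with $q\ge 2$ symbols. Let $\mathcal F=\{a_1,\dots,a_s\}$ be a finite collection of (forbidden) words over $\Sigma$, each of length at least $2$, and let $\Sigma_{\mathcal F}\subseteq\Sigma^{\mathbb N}$ be the set of one-sided sequences containing no word of $\mathcal F$ as a block (subword). A word is *allowed* if it is a block of some sequence in $\Sigma_{\mathcal F}$; $\mathcal L_n$ is the set of allowed words of length $n$. Assume that every symbol of $\Sigma$ is allowed. Let $\mathcal R=\{r_1,\dots,r_\ell\}$ be a finite collection of allowed (repeated) words with integer multiplicities $m_1,\dots,m_\ell\ge 2$. ($\mathcal F$ or $\mathcal R$ may be empty.) Assume that $\mathcal F\cup\mathcal R$ is reduced, i.e. none of the words $r_1,\dots,r_\ell,a_1,\dots,a_s$ is a subword of another one, and that the length $p$ of the longest word in $\mathcal F\cup\mathcal R$ is at least $2$. For a word $w$ put $m(w)=\prod_{i=1}^{\ell} m_i^{n(w;r_i)}$ if $w$ is allowed, where $n(w;r_i)$ is the number of occurrences of $r_i$ as a subword of $w$, and $m(w)=0$ otherwise. For $v=v_1\cdots v_n$ allowed put $k(v)=m(v)/m(v_2\cdots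 v_n)$. The adjacency matrix $A$ associated with $\mathcal F$ and $\mathcal R$ is indexed by $\mathcal L_{p-1}$: for $X=x_1\cdots x_{p-1}$, $Y=y_1\cdots y_{p-1}$, $A_{XY}=k(x_1\cdots x_{p-1}y_{p-1})$ if $x_2\cdots x_{p-1}=y_1\cdots y_{p-2}$ and $x_1\cdots x_{p-1}y_{p-1}\in\mathcal L_p$, and $A_{XY}=0$ otherwise. Assume that $A$ is irreducible. Let $f(0)=1$, $f(n)=\sum_{w\in\mathcal L_n}m(w)$ for $n\ge1$, and $F(z)=\sum_{n\ge 0}f(n)z^{-n}$. For words $u,v$ the correlation polynomial is $(u,v)_z=\sum_{i=1}^{|u|}c_iz^{|u|-i}$, where $c_i=1$ if, when $v$ is placed below $u$ with its first symbol under the $i$-th symbol of $u$, the overlapping segments of $u$ and $v$ are identical, and $c_i=0$ otherwise. Write $w_i=r_i$ for $1\le i\le \ell$ and $w_{\ell+j}=a_j$ for $1\le j\le s$. Let $D(z)$ be the diagonal matrix with $D_{ii}=z(1-\frac1{m_i})$ for $i\le\ell$ and $D_{ii}=-z$ for $\ell<i\le \ell+s$. Let $P(z)$ be the $(\ell+s)\times(\ell+s)$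 matrix with $$P(z)_{ij}=D_{jj}(z)\,(w_j,w_i)_z-\varepsilon_{ij}z^{|w_i|},$$ where $\varepsilon_{ij}=1$ if $i=j\le \ell$ and $\varepsilon_{ij}=0$ otherwise, and let $Q=D^{-1}P^{T}D$. Let $R_i(z)$ and $S_i(z)$ be the $i$-th row sums of the inverses $P(z)^{-1}$ and $Q(z)^{-1}$ over the field of rational functions. Theorem. As rational functions, $$z-q+z\sum_{i=1}^{\ell}\Bigl(1-\frac1{m_i}\Bigr)R_i(z)-z\sum_{j=1}^{s}R_{\ell+j}(z)\;=\;z-q+z\sum_{i=1}^{\ell}\Bigl(1-\frac1{m_i}\Bigr)S_i(z)-z\sum_{j=1}^{s}S_{\ell+j}(z).$$ Moreover $A$ has a Perron root $\theta$ (a real eigenvalue such that $|\mu|\le\theta$ for every complex eigenvalue $\mu$ of $A$), and $\theta$ is the largest real zero of this rational function. Furthermore, for all complex $z$ of sufficiently large modulus the series $F(z)$ converges and agrees with a rational function of $z$, and $\theta$ is also the largest real pole of that rational function. -/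

import Mathlib

namespace RepeatedWords

/-- A list `forb` of forbidden words `a₁, …, a_s` and a list `rep` of repeated words
`r₁, …, r_ℓ` with multiplicities `m₁, …, m_ℓ`, over the alphabet `α`. -/
structure Collections (α : Type*) (ℓ s : ℕ) where
  forb : Fin s → List α
  rep : Fin ℓ → List α
  mult : Fin ℓ → ℕ

variable {α : Type*} {ℓ s : ℕ}

/-- The block `x_k x_{k+1} … x_{k+n-1}` of the sequence `x`. -/
def block (x : ℕ → α) (k n : ℕ) : List α :=
  (List.range n).map fun t => x (k + t)

namespace Collections

/-- The words of both collections: first `r₁, …, r_ℓ`, then `a₁, …, a_s`. -/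
def word (W : Collections α ℓ s) : Fin ℓ ⊕ Fin s → List α :=
  Sum.elim W.rep W.forb

/-- The union of the two collections is reduced: no word is a subword of another one. -/
def IsReduced (W : Collections α ℓ s) : Prop :=
  ∀ i j, i ≠ j → ¬ W.word i <:+: W.word j

/-- The length `p` of the longest word in the two collections. -/
def maxLength (W : Collections α ℓ s) : ℕ :=
  Finset.univ.sup fun i => (W.word i).length

/-- The one-sided subshift of finite type: no forbidden word occurs as a block. -/
def shift (W : Collections α ℓ s) : Set (ℕ → α) :=
  {x | ∀ j k, block x k (W.forb j).length ≠ W.forb j}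

/-- A word is allowed if it occurs as a block of some sequence of the subshift. -/
def Allowed (W : Collections α ℓ s) (w : List α) : Prop :=
  ∃ x ∈ W.shift, ∃ k, block x k w.length = w

/-- The allowed words of length `n`. -/
def language (W : Collections α ℓ s) (n : ℕ) : Set (List α) :=
  {w | w.length = n ∧ W.Allowed w}

noncomputable instance [Fintype α] (W : Collections α ℓ s) (n : ℕ) :
    Fintype (W.language n) :=
  ((List.finite_length_eq α n).subset fun _ h => h.1).fintype

end Collections

/-- The number of occurrences of `r` as a subword of `w` (for nonempty `r`). -/
def occurrences [DecidableEq α] (w r : List α) : ℕ :=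
  ((Finset.range w.length).filter fun k => r <+: w.drop k).card

/-- For `X = x₁ … x_m` and `Y = y₁ … y_m` the word `x₁ … x_m y_m`. -/
def wordStar (X Y : List α) : List α :=
  X ++ Y.getLast?.toList

/-- `X * Y` is defined: `x₂ … x_m = y₁ … y_{m-1}`. -/
def StarDefined (X Y : List α) : Prop :=
  X.tail = Y.dropLast

open Polynomial in
/-- The correlation polynomial `(u, v)_z`: place `v` below `u`, with its first symbol under the
symbol of `u` at (zero-based) position `k`; if the overlapping segments agree, there is a term
of degree `|u| - 1 - k`. -/
noncomputable def corrPoly [DecidableEq α] (u v : List α) : ℝ[X] :=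
  ∑ k ∈ Finset.range u.length,
    if (u.drop k).take v.length = v.take (u.drop k).length then X ^ (u.length - 1 - k) else 0

namespace Collections

section Decidable

variable [DecidableEq α]

open Classical in
/-- The multiplicity `m(w)` of a word. -/
noncomputable def multiplicity (W : Collections α ℓ s) (w : List α) : ℕ :=
  if W.Allowed w then ∏ i, W.mult i ^ occurrences w (W.rep i) else 0

/-- `k(v) = m(v) / m(v₂ … v_n)`. -/
noncomputable def ratio (W : Collections α ℓ s) (v : List α) : ℝ :=
  (W.multiplicity v : ℝ) / (W.multiplicity v.tail : ℝ)

open Classical in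
/-- The adjacency matrix, indexed by the allowed words of length `p - 1`. -/
noncomputable def adjMatrix (W : Collections α ℓ s) :
    Matrix (W.language (W.maxLength - 1)) (W.language (W.maxLength - 1)) ℝ :=
  Matrix.of fun X Y =>
    if StarDefined X.1 Y.1 ∧ wordStar X.1 Y.1 ∈ W.language W.maxLength
    then W.ratio (wordStar X.1 Y.1) else 0

/-- `f(n)`, the number of allowed words of length `n` counted with multiplicity; `f(0) = 1`. -/
noncomputable def count [Fintype α] (W : Collections α ℓ s) (n : ℕ) : ℕ :=
  if n = 0 then 1 else ∑ w : W.language n, W.multiplicity w.1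

/-- The matrix function `P(z)`. -/
noncomputable def matrixP (W : Collections α ℓ s) :
    Matrix (Fin ℓ ⊕ Fin s) (Fin ℓ ⊕ Fin s) (RatFunc ℝ) :=
  Matrix.fromBlocks
    (Matrix.of fun i j =>
      RatFunc.X * RatFunc.C (1 - 1 / (W.mult j : ℝ)) *
          algebraMap _ (RatFunc ℝ) (corrPoly (W.rep j) (W.rep i)) -
        if i = j then RatFunc.X ^ (W.rep j).length else 0)
    (Matrix.of fun i j =>
      -(RatFunc.X * algebraMap _ (RatFunc ℝ) (corrPoly (W.forb j) (W.rep i))))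
    (Matrix.of fun i j =>
      RatFunc.X * RatFunc.C (1 - 1 / (W.mult j : ℝ)) *
        algebraMap _ (RatFunc ℝ) (corrPoly (W.rep j) (W.forb i)))
    (Matrix.of fun i j =>
      -(RatFunc.X * algebraMap _ (RatFunc ℝ) (corrPoly (W.forb j) (W.forb i))))

/-- The diagonal matrix function `D(z)`. -/
noncomputable def matrixD (W : Collections α ℓ s) :
    Matrix (Fin ℓ ⊕ Fin s) (Fin ℓ ⊕ Fin s) (RatFunc ℝ) :=
  Matrix.diagonal <| Sum.elim
    (fun i => RatFunc.X * RatFunc.C (1 - 1 / (W.mult i : ℝ))) (fun _ => -RatFunc.X)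

/-- The matrix function `Q = D⁻¹ Pᵀ D`. -/
noncomputable def matrixQ (W : Collections α ℓ s) :
    Matrix (Fin ℓ ⊕ Fin s) (Fin ℓ ⊕ Fin s) (RatFunc ℝ) :=
  W.matrixD⁻¹ * W.matrixP.transpose * W.matrixD

/-- The rational functions `R_i(z)`: row sums of `P(z)⁻¹`. -/
noncomputable def rowSumP (W : Collections α ℓ s) (i : Fin ℓ ⊕ Fin s) : RatFunc ℝ :=
  ∑ j, W.matrixP⁻¹ i j

/-- The rational functions `S_i(z)`: row sums of `Q(z)⁻¹`. -/
noncomputable def rowSumQ (W : Collections α ℓ s) (i : Fin ℓ ⊕ Fin s) : RatFunc ℝ :=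
  ∑ j, W.matrixQ⁻¹ i j

end Decidable

/-- `z - q + z ∑_{i ≤ ℓ} (1 - 1/m_i) T_i(z) - z ∑_{j ≤ s} T_{ℓ+j}(z)`, where `q = |α|`. -/
noncomputable def combination [Fintype α] (W : Collections α ℓ s)
    (T : Fin ℓ ⊕ Fin s → RatFunc ℝ) : RatFunc ℝ :=
  RatFunc.X - RatFunc.C (Fintype.card α : ℝ)
    + RatFunc.X * ∑ i : Fin ℓ, RatFunc.C (1 - 1 / (W.mult i : ℝ)) * T (Sum.inl i)
    - RatFunc.X * ∑ j : Fin s, T (Sum.inr j)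

end Collections

/-- The real zeros of a rational function (numerator in lowest terms vanishes). -/
def realZeros (G : RatFunc ℝ) : Set ℝ := {x | G.num.eval x = 0}

/-- The real poles of a rational function (denominator in lowest terms vanishes). -/
def realPoles (G : RatFunc ℝ) : Set ℝ := {x | G.denom.eval x = 0}

/-- `G` is the rational function given by `∑ f(n) z⁻ⁿ`: for all complex `z` of sufficiently
large modulus, the series converges to `G(z)`. -/
def IsGeneratingFunction (f : ℕ → ℕ) (G : RatFunc ℝ) : Prop :=
  ∀ᶠ z : ℂ in Bornology.cobounded ℂ,
    HasSum (fun n => (f n : ℂ) * (z⁻¹) ^ n) (G.eval (algebraMap ℝ ℂ) z)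

/-- `θ` is the Perron root of the real matrix `A`: it is an eigenvalue and it is largest among all
complex eigenvalues, in modulus. -/
def IsPerronRoot {ι : Type*} [Fintype ι] [DecidableEq ι] (A : Matrix ι ι ℝ) (θ : ℝ) : Prop :=
  Module.End.HasEigenvalue (Matrix.toLin' A) θ ∧
    ∀ μ : ℂ, Module.End.HasEigenvalue (Matrix.toLin' (A.map (algebraMap ℝ ℂ))) μ → ‖μ‖ ≤ θ

end RepeatedWords

open RepeatedWords

/-! Extend the multiplicity to all words by letting a repeated word contribute its multiplicity and
a forbidden word the factor 0. Then `weight` is nonzero exactly on the words avoiding the forbidden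
ones, whether or not they extend to a sequence of the subshift. Let G be the generating function in
1/z of the total weights of words of length n, and let E_i be that of the words ending with w_i,
weighted without their last symbol. As the collection is reduced, appending a symbol completes at
most one word. Hence `totalWeight_succ` and `endingWeight_add`, which become z = (z - q) G - z ∑
(factor i - 1) E_i and, after scaling E_i by m_i for repeated words, P(z) T = -G · 1. So R_i = -T_i
/ G, and the combination in the theorem is z / G (`invSeries_mul_combPoly`). Division by det P is
legitimate because P is dominated by its diagonal, column by column, for large z
(`det_polyP_ne_zero`). Passing to Q transposes the double sum ∑ D_ii (P⁻¹)_ij and changes nothing.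

F counts only allowed words. Prepending a symbol acts by A on the vector of weights sorted by prefix
of length p - 1 (`prefixWeight_succ`), so f(n + p - 1) = 1ᵀ Aⁿ m with m positive. By
Perron–Frobenius (`exists_perron`) f(n) lies between positive multiples of θⁿ for n ≥ p - 1, and the
resolvent of A shows that F is rational. A compactness argument (`exists_extension_bound`) bounds
the total weight of avoiding words of length n + N by a constant times f(n), so G grows at the same
rate as F.

The rest is analysis on the real line (`isRoot_and_cancel`): a series in 1/x with nonnegative
coefficients of growth θⁿ is finite for x > θ and tends to infinity as x decreases to θ. If it is
rational, its reduced denominator vanishes at θ and nowhere to the right. Applied to F this gives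
the largest pole, applied to G = z / combination the largest zero. -/

/-! ### The Perron root of an irreducible matrix -/

namespace Matrix

variable {ι : Type*} [Fintype ι]

/-- Some finite sum of powers of an irreducible matrix is entrywise positive. -/
theorem IsIrreducible.exists_sum_pow_pos [DecidableEq ι] {A : Matrix ι ι ℝ} (hA : A.IsIrreducible) :
    ∃ N : ℕ, ∀ i j, 0 < (∑ k ∈ Finset.range N, A ^ k) i j := by
  have h := (isIrreducible_iff_exists_pow_pos hA.nonneg).1 hA
  choose k _ hk using h
  refine ⟨Finset.univ.sup (fun ij : ι × ι => k ij.1 ij.2) + 1, fun i j => ?_⟩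
  rw [Matrix.sum_apply]
  refine Finset.sum_pos' (fun n _ => pow_apply_nonneg hA.nonneg n i j)
    ⟨k i j, Finset.mem_range.2 (Nat.lt_succ_of_le ?_), hk i j⟩
  exact Finset.le_sup (f := fun ij : ι × ι => k ij.1 ij.2) (Finset.mem_univ (i, j))

theorem mulVec_pos_of_pos {S : Matrix ι ι ℝ} (hS : ∀ i j, 0 < S i j) {x : ι → ℝ}
    (hx : ∀ i, 0 ≤ x i) (hx0 : x ≠ 0) (i : ι) : 0 < (S *ᵥ x) i := by
  obtain ⟨j, hj⟩ := Function.ne_iff.1 hx0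
  exact Finset.sum_pos' (fun k _ => mul_nonneg (hS i k).le (hx k))
    ⟨j, Finset.mem_univ j, mul_pos (hS i j) (lt_of_le_of_ne (hx j) (Ne.symm hj))⟩

/-- The maximum of the Collatz–Wielandt function is attained. -/
theorem exists_collatzWielandt_max [DecidableEq ι] [Nonempty ι] {A : Matrix ι ι ℝ} (hA : ∀ i j, 0 ≤ A i j) :
    ∃ θ : ℝ, 0 ≤ θ ∧
      (∃ x : ι → ℝ, (∀ i, 0 ≤ x i) ∧ x ≠ 0 ∧ ∀ i, θ * x i ≤ (A *ᵥ x) i) ∧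
      ∀ (y : ι → ℝ) (t : ℝ), (∀ i, 0 ≤ y i) → y ≠ 0 → 0 ≤ t →
        (∀ i, t * y i ≤ (A *ᵥ y) i) → t ≤ θ := by
  set B : ℝ := ∑ i, ∑ j, A i j
  have hB : 0 ≤ B := Finset.sum_nonneg fun i _ => Finset.sum_nonneg fun j _ => hA i j
  -- The minimum of (Ax)_i / x_i need not be continuous where coordinates of x vanish. Maximizing t
  -- over the closed set of pairs (x, t) with t x ≤ A x avoids this; `B` bounds t because the
  -- coordinates of x sum to 1.
  let K : Set ((ι → ℝ) × ℝ) :=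
    (stdSimplex ℝ ι ×ˢ Set.Icc 0 B) ∩ {z | ∀ i, z.2 * z.1 i ≤ (A *ᵥ z.1) i}
  have hK : IsCompact K := by
    refine ((isCompact_stdSimplex ℝ ι).prod isCompact_Icc).inter_right ?_
    simp only [Set.ofPred_forall]
    refine isClosed_iInter fun i => isClosed_le (by fun_prop) ?_
    simp only [mulVec, dotProduct]
    fun_prop
  have hKne : K.Nonempty := by
    refine ⟨(Pi.single (Classical.arbitrary ι) 1, 0), ⟨single_mem_stdSimplex ℝ _, le_rfl, hB⟩, ?_⟩
    intro i
    simp [hA]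
  obtain ⟨⟨x, θ⟩, ⟨⟨hx, hθ⟩, hxθ⟩, hmax⟩ := hK.exists_isMaxOn hKne continuous_snd.continuousOn
  refine ⟨θ, hθ.1, ⟨x, hx.1, ?_, hxθ⟩, ?_⟩
  · rintro rfl
    simpa using hx.2
  · intro y t hy hy0 ht hyt
    have hs : 0 < ∑ i, y i := by
      obtain ⟨j, hj⟩ := Function.ne_iff.1 hy0
      exact Finset.sum_pos' (fun k _ => hy k)
        ⟨j, Finset.mem_univ j, lt_of_le_of_ne (hy j) (Ne.symm hj)⟩
    set s := ∑ i, y i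
    have hmem : s⁻¹ • y ∈ stdSimplex ℝ ι := by
      refine ⟨fun i => mul_nonneg (inv_nonneg.2 hs.le) (hy i), ?_⟩
      simp only [Pi.smul_apply, smul_eq_mul]
      rw [← Finset.mul_sum]
      exact inv_mul_cancel₀ hs.ne'
    have hineq : ∀ i, t * (s⁻¹ • y) i ≤ (A *ᵥ (s⁻¹ • y)) i := by
      intro i
      rw [mulVec_smul, Pi.smul_apply, Pi.smul_apply, smul_eq_mul, smul_eq_mul, mul_left_comm]
      exact mul_le_mul_of_nonneg_left (hyt i) (inv_nonneg.2 hs.le)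
    have htB : t ≤ B := by
      calc t = ∑ i, t * (s⁻¹ • y) i := by rw [← Finset.mul_sum, hmem.2, mul_one]
        _ ≤ ∑ i, (A *ᵥ (s⁻¹ • y)) i := Finset.sum_le_sum fun i _ => hineq i
        _ ≤ B := Finset.sum_le_sum fun i _ => Finset.sum_le_sum fun j _ =>
          mul_le_of_le_one_right (hA i j) ?_
      rw [← hmem.2]
      exact Finset.single_le_sum (fun k _ => hmem.1 k) (Finset.mem_univ j)
    exact hmax (a := (s⁻¹ • y, t)) ⟨⟨hmem, ht, htB⟩, hineq⟩

/-- **Perron–Frobenius**: an irreducible matrix has a positive eigenvalue, with a positive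
eigenvector, which dominates all complex eigenvalues. -/
theorem IsIrreducible.exists_perron [DecidableEq ι] [Nonempty ι] {A : Matrix ι ι ℝ} (hA : A.IsIrreducible) :
    ∃ (θ : ℝ) (v : ι → ℝ), 0 < θ ∧ (∀ i, 0 < v i) ∧ A *ᵥ v = θ • v ∧
      RepeatedWords.IsPerronRoot A θ := by
  obtain ⟨θ, hθ, ⟨x, hx, hx0, hxθ⟩, hmax⟩ := exists_collatzWielandt_max hA.nonneg
  obtain ⟨N, hN⟩ := hA.exists_sum_pow_pos
  set S := ∑ k ∈ Finset.range N, A ^ k with hS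
  have hSA : A * S = S * A := by
    rw [hS, Finset.mul_sum, Finset.sum_mul]
    exact Finset.sum_congr rfl fun k _ => by rw [← pow_succ, ← pow_succ']
  have hSx := mulVec_pos_of_pos hN hx hx0
  -- Otherwise A x - θ x is nonnegative and nonzero, so the positive matrix `S`, which commutes with
  -- A, makes A(S x) > θ (S x) in every coordinate. The least ratio `t` then contradicts the
  -- maximality of θ.
  have heig : A *ᵥ x = θ • x := by
    by_contra hne
    have hpos := mulVec_pos_of_pos hN (x := A *ᵥ x - θ • x)
      (fun i => sub_nonneg.2 (hxθ i)) (sub_ne_zero.2 hne)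
    have hlt : ∀ i, θ < (A *ᵥ (S *ᵥ x)) i / (S *ᵥ x) i := by
      intro i
      rw [lt_div_iff₀ (hSx i)]
      have := hpos i
      rw [mulVec_sub, mulVec_mulVec, ← hSA, ← mulVec_mulVec, mulVec_smul] at this
      simpa using this
    set t := Finset.univ.inf' Finset.univ_nonempty fun i => (A *ᵥ (S *ᵥ x)) i / (S *ᵥ x) i
    have ht : θ < t := by
      rw [Finset.lt_inf'_iff]
      exact fun i _ => hlt i
    refine absurd (hmax (S *ᵥ x) t (fun i => (hSx i).le) ?_ (hθ.trans ht.le) ?_) (not_le.2 ht)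
    · intro h
      exact (hSx (Classical.arbitrary ι)).ne' (congrFun h _)
    · intro i
      rw [← le_div_iff₀ (hSx i)]
      exact Finset.inf'_le _ (Finset.mem_univ i)
  have hpow : ∀ k : ℕ, A ^ k *ᵥ x = θ ^ k • x := by
    intro k
    induction k with
    | zero => simp
    | succ k ih => rw [pow_succ, ← mulVec_mulVec, heig, mulVec_smul, ih, smul_smul, pow_succ']
  have hSx' : S *ᵥ x = (∑ k ∈ Finset.range N, θ ^ k) • x := by
    rw [hS, sum_mulVec, Finset.sum_smul]
    exact Finset.sum_congr rfl fun k _ => hpow k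
  have hxpos : ∀ i, 0 < x i := by
    intro i
    have h := hSx i
    rw [hSx'] at h
    exact pos_of_mul_pos_right h (Finset.sum_nonneg fun k _ => pow_nonneg hθ k)
  -- Some power of A has a positive diagonal entry, whereas θ = 0 would give A ^ k x = 0.
  have hθpos : 0 < θ := by
    let i := Classical.arbitrary ι
    obtain ⟨k, hk, hki⟩ := (isIrreducible_iff_exists_pow_pos hA.nonneg).1 hA i i
    refine lt_of_le_of_ne hθ fun h0 => ?_
    have h := congrFun (hpow k) i
    rw [← h0, zero_pow hk.ne', zero_smul] at h
    have : 0 < (A ^ k *ᵥ x) i :=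
      Finset.sum_pos' (fun j _ => mul_nonneg (pow_apply_nonneg hA.nonneg k i j) (hx j))
        ⟨i, Finset.mem_univ i, mul_pos hki (hxpos i)⟩
    exact this.ne' h
  refine ⟨θ, x, hθpos, hxpos, heig, ?_, ?_⟩
  · exact Module.End.hasEigenvalue_of_hasEigenvector (x := x)
      ⟨Module.End.mem_eigenspace_iff.2 (by simpa using heig), hx0⟩
  -- The triangle inequality gives |μ| |z| ≤ A |z|, so |z| competes in the Collatz–Wielandt maximum.
  · intro μ hμ
    obtain ⟨z, hz⟩ := hμ.exists_hasEigenvector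
    have hz' : A.map (algebraMap ℝ ℂ) *ᵥ z = μ • z := by
      simpa using hz.apply_eq_smul
    refine hmax (fun i => ‖z i‖) ‖μ‖ (fun i => norm_nonneg _) ?_ (norm_nonneg _) fun i => ?_
    · intro h
      exact hz.2 (funext fun i => norm_eq_zero.1 (congrFun h i))
    · have := congrFun hz' i
      calc ‖μ‖ * ‖z i‖ = ‖(A.map (algebraMap ℝ ℂ) *ᵥ z) i‖ := by rw [this]; simp
        _ ≤ ∑ j, ‖(A.map (algebraMap ℝ ℂ)) i j * z j‖ := norm_sum_le _ _
        _ = (A *ᵥ fun i => ‖z i‖) i := by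
          refine Finset.sum_congr rfl fun j _ => ?_
          simp [abs_of_nonneg (hA.nonneg i j)]

end Matrix

/-! ### Power series in `1 / x` with nonnegative coefficients of exponential growth -/

section GrowthSeries

open Filter Topology Polynomial

/-- The sum `∑ cₙ x⁻ⁿ`. -/
noncomputable def invSeries (c : ℕ → ℝ) (x : ℝ) : ℝ := ∑' n, c n * (x⁻¹) ^ n

/-- `c` is nonnegative and grows like `θⁿ`: the series `∑ cₙ x⁻ⁿ` converges for `x > θ`, and
`cₙ` is bounded below by a multiple of `θⁿ`. -/
structure HasGrowth (c : ℕ → ℝ) (θ : ℝ) : Prop where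
  pos : 0 < θ
  nonneg : ∀ n, 0 ≤ c n
  summable : ∀ x, θ < x → Summable fun n => c n * (x⁻¹) ^ n
  lower : ∃ κ : ℝ, 0 < κ ∧ ∃ N : ℕ, ∀ n, N ≤ n → κ * θ ^ n ≤ c n

namespace HasGrowth

variable {c : ℕ → ℝ} {θ : ℝ}

theorem term_nonneg (h : HasGrowth c θ) {x : ℝ} (hx : 0 < x) (n : ℕ) :
    0 ≤ c n * (x⁻¹) ^ n :=
  mul_nonneg (h.nonneg n) (pow_nonneg (inv_nonneg.2 hx.le) n)

theorem invSeries_nonneg (h : HasGrowth c θ) {x : ℝ} (hx : 0 < x) : 0 ≤ invSeries c x :=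
  tsum_nonneg fun n => h.term_nonneg hx n

theorem invSeries_anti (h : HasGrowth c θ) {x y : ℝ} (hx : θ < x) (hxy : x ≤ y) :
    invSeries c y ≤ invSeries c x := by
  have hx0 := h.pos.trans hx
  refine (h.summable y (hx.trans_le hxy)).tsum_le_tsum (fun n => ?_) (h.summable x hx)
  refine mul_le_mul_of_nonneg_left ?_ (h.nonneg n)
  exact pow_le_pow_left₀ (inv_nonneg.2 (hx0.trans_le hxy).le) (inv_anti₀ hx0 hxy) n

/-- At x = θ each late term is at least κ, so a block of M terms exceeds any given K once M κ > K.
The block is continuous in x, and for x > θ it is at most the full sum. -/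
theorem tendsto_invSeries (h : HasGrowth c θ) : Tendsto (invSeries c) (𝓝[>] θ) atTop := by
  obtain ⟨κ, hκ, N, hN⟩ := h.lower
  refine tendsto_atTop.2 fun K => ?_
  obtain ⟨M, hM⟩ := exists_nat_gt (K / κ)
  have hcont : ContinuousAt (fun x : ℝ => ∑ n ∈ Finset.Ico N (N + M), c n * (x⁻¹) ^ n) θ := by
    have h0 := h.pos.ne'
    fun_prop (disch := assumption)
  have hval : K < ∑ n ∈ Finset.Ico N (N + M), c n * (θ⁻¹) ^ n := by
    calc K < M * κ := (div_lt_iff₀ hκ).1 hM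
      _ = ∑ n ∈ Finset.Ico N (N + M), κ := by simp
      _ ≤ _ := Finset.sum_le_sum fun n hn => ?_
    rw [inv_pow, ← div_eq_mul_inv, le_div_iff₀ (pow_pos h.pos n)]
    exact hN n (Finset.mem_Ico.1 hn).1
  filter_upwards [(hcont.eventually (lt_mem_nhds hval)).filter_mono nhdsWithin_le_nhds,
    self_mem_nhdsWithin] with x hx hxθ
  exact hx.le.trans ((h.summable x hxθ).sum_le_tsum _
    fun n _ => h.term_nonneg (h.pos.trans hxθ) n)

/-- If `∑ cₙ x⁻ⁿ` agrees with the quotient `b / a` of polynomials for `x > θ`, then `a` vanishes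
at `θ`, and the zeros of `a` on the right of `θ` cancel. -/
theorem isRoot_and_cancel (h : HasGrowth c θ) {a b e : ℝ[X]} (he : e ≠ 0)
    (hab : ∀ x, θ < x → invSeries c x * (a.eval x * e.eval x) = b.eval x * e.eval x) :
    a.eval θ = 0 ∧ ∀ x, θ < x → a.eval x = 0 → b.eval x = 0 := by
  -- The factor `e` has finitely many zeros, so it can be divided out just to the right of any
  -- point.
  have hroots : ∀ x₀ : ℝ, ∀ᶠ x in 𝓝[>] x₀, e.eval x ≠ 0 := by
    intro x₀
    have hfin : {x | e.eval x = 0}.Finite := by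
      refine e.roots.toFinset.finite_toSet.subset fun x hx => ?_
      simpa [he] using hx
    have : ∀ᶠ x in 𝓝[≠] x₀, e.eval x ≠ 0 := by
      have h1 := (hfin.subset (Set.sdiff_subset (t := {x₀}))).isClosed.isOpen_compl.mem_nhds
        (x := x₀) (by simp)
      filter_upwards [nhdsWithin_le_nhds h1, self_mem_nhdsWithin] with x hx hx' hex
      exact hx ⟨hex, hx'⟩
    exact this.filter_mono (nhdsWithin_mono _ fun x hx => ne_of_gt hx)
  have hquot : ∀ x₀, θ ≤ x₀ → ∀ᶠ x in 𝓝[>] x₀, invSeries c x * a.eval x = b.eval x := by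
    intro x₀ hx₀
    filter_upwards [hroots x₀, self_mem_nhdsWithin] with x hx hxx
    have := hab x (hx₀.trans_lt hxx)
    rw [← mul_assoc] at this
    exact mul_right_cancel₀ hx this
  have hlim : ∀ (p : ℝ[X]) (x₀ : ℝ), Tendsto (fun x => p.eval x) (𝓝[>] x₀) (𝓝 (p.eval x₀)) :=
    fun p x₀ => p.continuous.continuousAt.tendsto.mono_left nhdsWithin_le_nhds
  constructor
  -- Near θ, a = b / series, with b bounded and the series tending to infinity.
  · have h1 : Tendsto (fun x => b.eval x * (invSeries c x)⁻¹) (𝓝[>] θ) (𝓝 (b.eval θ * 0)) :=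
      (hlim b θ).mul h.tendsto_invSeries.inv_tendsto_atTop
    rw [mul_zero] at h1
    refine tendsto_nhds_unique (hlim a θ) (h1.congr' ?_)
    filter_upwards [hquot θ le_rfl, h.tendsto_invSeries.eventually_gt_atTop 0] with x hx hx0
    rw [← hx]
    field_simp
  -- To the right of x₁ > θ the series is at most its value at x₁, so |b| ≤ const · |a| near x₀.
  · intro x₀ hx₀ ha
    obtain ⟨x₁, hx₁, hx₁₀⟩ := exists_between hx₀
    have h1 : Tendsto (fun x => invSeries c x₁ * |a.eval x|) (𝓝[>] x₀)
        (𝓝 (invSeries c x₁ * |a.eval x₀|)) := (hlim a x₀).abs.const_mul _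
    rw [ha, abs_zero, mul_zero] at h1
    have h2 : Tendsto (fun x => b.eval x) (𝓝[>] x₀) (𝓝 0) := by
      refine squeeze_zero_norm' ?_ h1
      filter_upwards [hquot x₀ hx₀.le, self_mem_nhdsWithin] with x hx hxx
      have hxx : x₀ < x := hxx
      rw [← hx, Real.norm_eq_abs, abs_mul,
        abs_of_nonneg (h.invSeries_nonneg (h.pos.trans (hx₀.trans hxx)))]
      exact mul_le_mul_of_nonneg_right (h.invSeries_anti hx₁ (hx₁₀.trans hxx).le) (abs_nonneg _)
    exact tendsto_nhds_unique (hlim b x₀) h2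

end HasGrowth

end GrowthSeries

namespace RepeatedWords
variable {α : Type*} {ℓ s : ℕ}

/-! ### Occurrences of a subword -/

section Occurrences

variable [DecidableEq α]

theorem occurrences_nil (r : List α) : occurrences [] r = 0 := rfl

theorem occurrences_cons (x : α) (w r : List α) :
    occurrences (x :: w) r = (if r <+: x :: w then 1 else 0) + occurrences w r := by
  unfold occurrences
  rw [List.length_cons, Finset.range_add_one', Finset.filter_insert, Finset.filter_map,
    ← Finset.card_map (s := (Finset.range w.length).filter fun k => r <+: w.drop k)
      ⟨fun i => i + 1, fun i j => by simp⟩]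
  have h : (Finset.range w.length).filter ((fun k => r <+: (x :: w).drop k) ∘
      (⟨fun i => i + 1, fun i j => by simp⟩ : ℕ ↪ ℕ)) =
      (Finset.range w.length).filter fun k => r <+: w.drop k := by
    ext k
    simp only [Finset.mem_filter]
    exact Iff.rfl
  rw [h]
  split_ifs with h1 h2 h2
  · rw [Finset.card_insert_of_notMem (by simp), add_comm]
  · exact absurd h1 h2
  · exact absurd h2 h1
  · simp

/-- Occurrences are indexed by starting positions, while the recurrences need ending positions. In
the induction from the left, the only case where a prefix occurrence has to be traded for a suffix
occurrence is r equal to the whole word. -/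
theorem occurrences_concat {r : List α} (hr : r ≠ []) (w : List α) (x : α) :
    occurrences (w ++ [x]) r = occurrences w r + if r <:+ w ++ [x] then 1 else 0 := by
  induction w with
  | nil =>
    rw [List.nil_append, occurrences_cons, occurrences_nil, add_zero, zero_add]
    have : r <+: [x] ↔ r <:+ [x] := by
      cases r with
      | nil => simp
      | cons a t =>
        simp only [List.cons_prefix_cons, List.prefix_nil, List.suffix_cons_iff, List.suffix_nil]
        simp
    simp [this]
  | cons y w ih =>
    rw [List.cons_append, occurrences_cons, ih, occurrences_cons]
    have h1 : r <+: y :: (w ++ [x]) ↔ r = y :: (w ++ [x]) ∨ r <+: y :: w := by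
      rw [← List.cons_append, List.prefix_concat_iff]
    simp only [h1, List.suffix_cons_iff]
    by_cases h : r = y :: (w ++ [x])
    · have h2 : ¬ r <+: y :: w := fun h' => by
        have := h'.length_le
        simp [h] at this
      have h3 : ¬ r <:+ w ++ [x] := fun h' => by
        have := h'.length_le
        simp [h] at this
      rw [if_pos (Or.inl h), if_neg h2, if_neg h3, if_pos (Or.inl h)]
      ring
    · simp only [h, false_or]
      ring

theorem occurrences_eq_zero_iff {r : List α} (hr : r ≠ []) (w : List α) :
    occurrences w r = 0 ↔ ¬ r <:+: w := by
  induction w with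
  | nil => simp [occurrences_nil, hr]
  | cons x w ih =>
    rw [occurrences_cons, List.infix_cons_iff, Nat.add_eq_zero_iff, ih]
    simp

end Occurrences

/-! ### Sums over the words of a given length -/

section Words

variable [Fintype α]

/-- All words of length `n`. -/
noncomputable def words (α : Type*) [Fintype α] (n : ℕ) : Finset (List α) :=
  (List.finite_length_eq α n).toFinset

@[simp]
theorem mem_words {n : ℕ} {w : List α} : w ∈ words α n ↔ w.length = n := by
  simp [words]

theorem sum_words_zero (φ : List α → ℝ) : ∑ w ∈ words α 0, φ w = φ [] := by
  have : words α 0 = {[]} := by ext w; simp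
  rw [this, Finset.sum_singleton]

theorem sum_words_add (a b : ℕ) (φ : List α → ℝ) :
    ∑ w ∈ words α (a + b), φ w = ∑ u ∈ words α a, ∑ v ∈ words α b, φ (u ++ v) := by
  rw [← Finset.sum_product']
  symm
  refine Finset.sum_bij' (fun p _ => p.1 ++ p.2) (fun w _ => (w.take a, w.drop a)) ?_ ?_ ?_ ?_ ?_
  · rintro ⟨u, v⟩ h
    simp only [Finset.mem_product, mem_words] at h ⊢
    simp [h.1, h.2]
  · intro w h
    rw [mem_words] at h
    simp [h]
  · rintro ⟨u, v⟩ h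
    simp only [Finset.mem_product, mem_words] at h
    simp [← h.1]
  · intro w _
    simp
  · intro _ _
    rfl

theorem sum_words_one (φ : List α → ℝ) : ∑ w ∈ words α 1, φ w = ∑ x, φ [x] := by
  symm
  refine Finset.sum_bij (fun x _ => [x]) (by simp) (by simp) ?_ (fun _ _ => rfl)
  intro w hw
  obtain ⟨x, rfl⟩ := List.length_eq_one_iff.1 (mem_words.1 hw)
  exact ⟨x, Finset.mem_univ x, rfl⟩

theorem sum_words_succ (n : ℕ) (φ : List α → ℝ) :
    ∑ w ∈ words α (n + 1), φ w = ∑ w ∈ words α n, ∑ x, φ (w ++ [x]) := by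
  rw [sum_words_add]
  exact Finset.sum_congr rfl fun w _ => sum_words_one _

/-- Summing over the words with a fixed suffix. -/
theorem sum_words_append [DecidableEq α] (n : ℕ) (p : List α) (φ : List α → ℝ) :
    ∑ w ∈ words α n, φ (w ++ p) =
      ∑ w ∈ words α (n + p.length), if p <:+ w then φ w else 0 := by
  rw [sum_words_add]
  refine Finset.sum_congr rfl fun w hw => ?_
  rw [Finset.sum_eq_single p]
  · simp
  · intro v hv hvp
    rw [if_neg]
    intro h
    exact hvp ((List.suffix_of_suffix_length_le h (List.suffix_append w v)
      (mem_words.1 hv).ge).eq_of_length (mem_words.1 hv).symm).symm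
  · simp

end Words

/-! ### Weights of words -/

namespace Collections

/-- The factor contributed by one occurrence of a word: its multiplicity if it is a repeated
word, and `0` if it is forbidden. -/
def factor (W : Collections α ℓ s) : Fin ℓ ⊕ Fin s → ℝ :=
  Sum.elim (fun i => (W.mult i : ℝ)) 0

theorem factor_nonneg (W : Collections α ℓ s) (i : Fin ℓ ⊕ Fin s) : 0 ≤ W.factor i := by
  rcases i with i | i <;> simp [factor]

/-- In a reduced collection at most one word is a suffix of a given word. -/
theorem IsReduced.suffix_unique {W : Collections α ℓ s} (hred : W.IsReduced) {w : List α}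
    {i j : Fin ℓ ⊕ Fin s} (hi : W.word i <:+ w) (hj : W.word j <:+ w) : i = j := by
  by_contra h
  rcases List.suffix_or_suffix_of_suffix hi hj with h' | h'
  · exact hred i j h h'.isInfix
  · exact hred j i (Ne.symm h) h'.isInfix

/-- In a reduced collection no word is contained in a proper prefix of a word, so a word that ends
together with such a prefix ends with the whole prefix. -/
theorem IsReduced.take_suffix {W : Collections α ℓ s} (hred : W.IsReduced)
    {i j : Fin ℓ ⊕ Fin s} {n : ℕ} (hn : n < (W.word i).length) {w : List α}
    (h : W.word j <:+ w ++ (W.word i).take n) : (W.word i).take n <:+ W.word j := by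
  rcases List.suffix_or_suffix_of_suffix h (List.suffix_append w _) with h' | h'
  · have hlen := h'.length_le
    have hinf := h'.isInfix.trans (List.take_prefix n (W.word i)).isInfix
    by_cases hji : j = i
    · subst hji
      simp at hlen
      omega
    · exact absurd hinf (hred j i hji)
  · exact h'

section Weight

variable [DecidableEq α]

/-- The multiplicity of a word that need not be extendable: `0` if the word contains a forbidden
word. -/
noncomputable def weight (W : Collections α ℓ s) (w : List α) : ℝ :=
  ∏ i, W.factor i ^ occurrences w (W.word i)

theorem weight_nonneg (W : Collections α ℓ s) (w : List α) : 0 ≤ W.weight w :=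
  Finset.prod_nonneg fun i _ => pow_nonneg (W.factor_nonneg i) _

theorem weight_nil (W : Collections α ℓ s) : W.weight [] = 1 := by
  simp [weight, occurrences_nil]

/-- At most one word of a reduced collection ends at the new symbol, so the product of the new
factors has at most one nontrivial term and can be written as a sum. -/
theorem weight_concat {W : Collections α ℓ s} (hred : W.IsReduced) (hne : ∀ i, W.word i ≠ [])
    (w : List α) (x : α) :
    W.weight (w ++ [x]) = W.weight w +
      ∑ i, (W.factor i - 1) * if W.word i <:+ w ++ [x] then W.weight w else 0 := by
  have h1 : W.weight (w ++ [x]) =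
      W.weight w * ∏ i, W.factor i ^ (if W.word i <:+ w ++ [x] then 1 else 0) := by
    rw [weight, weight, ← Finset.prod_mul_distrib]
    exact Finset.prod_congr rfl fun i _ => by rw [occurrences_concat (hne i), pow_add]
  rw [h1]
  by_cases h : ∃ i, W.word i <:+ w ++ [x]
  · obtain ⟨i, hi⟩ := h
    have hj : ∀ j, j ≠ i → ¬ W.word j <:+ w ++ [x] :=
      fun j hji hj => hji (hred.suffix_unique hj hi)
    rw [Finset.prod_eq_single i (fun j _ hji => by simp [hj j hji]) (by simp),
      Finset.sum_eq_single i (fun j _ hji => by simp [hj j hji]) (by simp), if_pos hi, if_pos hi]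
    ring
  · push Not at h
    simp [h]

theorem weight_append_take {W : Collections α ℓ s} (hred : W.IsReduced)
    (hne : ∀ i, W.word i ≠ []) (w u : List α) {n : ℕ} (hn : n ≤ u.length) :
    W.weight (w ++ u.take n) = W.weight w + ∑ t ∈ Finset.range n, ∑ i, (W.factor i - 1) *
      if W.word i <:+ w ++ u.take (t + 1) then W.weight (w ++ u.take (t + 1)).dropLast else 0 := by
  induction n with
  | zero => simp
  | succ n ih =>
    rw [Finset.sum_range_succ, ← add_assoc, ← ih (Nat.le_of_succ_le hn),
      List.take_add_one, List.getElem?_eq_getElem hn, Option.toList_some, ← List.append_assoc,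
      weight_concat hred hne, List.dropLast_concat]

end Weight

/-! ### Recurrences for the weighted numbers of words -/

section Recurrence

variable [Fintype α] [DecidableEq α]

/-- The total weight of the words of length `n`. -/
noncomputable def totalWeight (W : Collections α ℓ s) (n : ℕ) : ℝ :=
  ∑ w ∈ words α n, W.weight w

/-- The total weight, not counting the last occurrence, of the words of length `n` that end with
a given word of the collection. -/
noncomputable def endingWeight (W : Collections α ℓ s) (i : Fin ℓ ⊕ Fin s) (n : ℕ) : ℝ :=
  ∑ w ∈ words α n, if W.word i <:+ w then W.weight w.dropLast else 0

theorem totalWeight_zero (W : Collections α ℓ s) : W.totalWeight 0 = 1 := by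
  rw [totalWeight, sum_words_zero, weight_nil]

theorem totalWeight_nonneg (W : Collections α ℓ s) (n : ℕ) : 0 ≤ W.totalWeight n :=
  Finset.sum_nonneg fun w _ => W.weight_nonneg w

theorem endingWeight_nonneg (W : Collections α ℓ s) (i : Fin ℓ ⊕ Fin s) (n : ℕ) :
    0 ≤ W.endingWeight i n :=
  Finset.sum_nonneg fun w _ => by split_ifs; exacts [W.weight_nonneg _, le_rfl]

theorem endingWeight_of_lt (W : Collections α ℓ s) {i : Fin ℓ ⊕ Fin s} {n : ℕ}
    (h : n < (W.word i).length) : W.endingWeight i n = 0 := by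
  refine Finset.sum_eq_zero fun w hw => if_neg fun h' => ?_
  rw [← mem_words.1 hw] at h
  exact absurd h'.length_le (not_le.2 h)

theorem endingWeight_succ_le (W : Collections α ℓ s) (i : Fin ℓ ⊕ Fin s) (n : ℕ) :
    W.endingWeight i (n + 1) ≤ Fintype.card α * W.totalWeight n := by
  rw [endingWeight, sum_words_succ, totalWeight, Finset.mul_sum]
  refine Finset.sum_le_sum fun w _ => ?_
  calc _ ≤ ∑ _x : α, W.weight w := Finset.sum_le_sum fun x _ => by
        rw [List.dropLast_concat]
        split_ifs
        exacts [le_rfl, W.weight_nonneg _]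
    _ = _ := by simp

theorem totalWeight_succ {W : Collections α ℓ s} (hred : W.IsReduced) (hne : ∀ i, W.word i ≠ [])
    (n : ℕ) :
    W.totalWeight (n + 1) = Fintype.card α * W.totalWeight n +
      ∑ i, (W.factor i - 1) * W.endingWeight i (n + 1) := by
  simp only [totalWeight, endingWeight, sum_words_succ, weight_concat hred hne,
    Finset.sum_add_distrib, List.dropLast_concat]
  congr 1
  · simp [Finset.mul_sum]
  · simp only [Finset.mul_sum]
    symm
    rw [Finset.sum_comm]
    exact Finset.sum_congr rfl fun w _ => Finset.sum_comm

/-- Write a word ending with w_i as w followed by w_i, and append w_i without its last symbol one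
symbol at a time. A word w_j completed on the way ends with the prefix of w_i appended so far, by
`take_suffix`. Hence the correction terms are indexed by the overlaps of w_j with w_i, and each is
an `endingWeight` of w_j. -/
theorem endingWeight_add {W : Collections α ℓ s} (hred : W.IsReduced) (hne : ∀ i, W.word i ≠ [])
    (i : Fin ℓ ⊕ Fin s) (n : ℕ) :
    W.endingWeight i (n + (W.word i).length) = W.totalWeight n +
      ∑ j, (W.factor j - 1) * ∑ t ∈ Finset.range ((W.word i).length - 1),
        if (W.word i).take (t + 1) <:+ W.word j then W.endingWeight j (n + (t + 1)) else 0 := by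
  have hpos : 0 < (W.word i).length := List.length_pos_iff.2 (hne i)
  have h0 : W.endingWeight i (n + (W.word i).length) =
      ∑ w ∈ words α n, W.weight (w ++ (W.word i).take ((W.word i).length - 1)) := by
    rw [endingWeight, ← sum_words_append n (W.word i) fun w => W.weight w.dropLast]
    refine Finset.sum_congr rfl fun w _ => ?_
    rw [List.dropLast_append_of_ne_nil (hne i), List.dropLast_eq_take]
  have h1 : ∀ j, ∀ t ∈ Finset.range ((W.word i).length - 1),
      (∑ w ∈ words α n, if W.word j <:+ w ++ (W.word i).take (t + 1)
        then W.weight (w ++ (W.word i).take (t + 1)).dropLast else 0) =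
      if (W.word i).take (t + 1) <:+ W.word j then W.endingWeight j (n + (t + 1)) else 0 := by
    intro j t ht
    have ht' : t + 1 < (W.word i).length := by
      have := Finset.mem_range.1 ht
      omega
    rw [sum_words_append n ((W.word i).take (t + 1))
      fun w => if W.word j <:+ w then W.weight w.dropLast else 0,
      List.length_take, min_eq_left ht'.le]
    split_ifs with h
    · refine Finset.sum_congr rfl fun w _ => ?_
      by_cases hj : W.word j <:+ w
      · rw [if_pos (h.trans hj)]
      · simp [hj]
    · refine Finset.sum_eq_zero fun w _ => ?_
      split_ifs with h2 h3
      · obtain ⟨v, rfl⟩ := h2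
        exact absurd (hred.take_suffix ht' h3) h
      · rfl
      · rfl
  rw [h0]
  simp only [weight_append_take hred hne _ (W.word i) (Nat.sub_le _ 1), Finset.sum_add_distrib]
  congr 1
  rw [Finset.sum_comm]
  simp only [Finset.sum_comm (s := words α n), ← Finset.mul_sum]
  rw [Finset.sum_comm]
  refine Finset.sum_congr rfl fun j _ => ?_
  rw [Finset.mul_sum]
  exact Finset.sum_congr rfl fun t ht => by rw [h1 j t ht]

end Recurrence

open Polynomial

/-! ### The correlation matrix over the polynomials -/

/-- The coefficients `1 - 1 / m_i` and `-1` of the diagonal matrix `D(z)`. -/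
noncomputable def coef (W : Collections α ℓ s) : Fin ℓ ⊕ Fin s → ℝ :=
  Sum.elim (fun i => 1 - 1 / (W.mult i : ℝ)) fun _ => -1

/-- `1` for the repeated words and `0` for the forbidden ones. -/
def repIndicator : Fin ℓ ⊕ Fin s → ℝ := Sum.elim (fun _ => 1) fun _ => 0

/-- The multiplicity of a repeated word, and `1` for the forbidden words. -/
def scale (W : Collections α ℓ s) : Fin ℓ ⊕ Fin s → ℝ :=
  Sum.elim (fun i => (W.mult i : ℝ)) fun _ => 1

/-- The recurrences carry the coefficients m_i - 1 and -1, whereas P carries 1 - 1/m_i and -1.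
Scaling the unknowns by `scale` reconciles the two. -/
theorem coef_mul_scale {W : Collections α ℓ s} (hmult : ∀ i, 2 ≤ W.mult i)
    (j : Fin ℓ ⊕ Fin s) : W.coef j * W.scale j = W.factor j - 1 := by
  rcases j with j | j
  · have : (W.mult j : ℝ) ≠ 0 := by have := hmult j; positivity
    simp [coef, scale, factor]
    field_simp
  · simp [coef, scale, factor]

theorem repIndicator_mul_scale (W : Collections α ℓ s) (j : Fin ℓ ⊕ Fin s) :
    repIndicator j * W.scale j = W.factor j := by
  rcases j with j | j <;> simp [repIndicator, scale, factor]

theorem coef_sub_repIndicator_ne_zero {W : Collections α ℓ s} (hmult : ∀ i, 2 ≤ W.mult i)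
    (j : Fin ℓ ⊕ Fin s) : W.coef j - repIndicator j ≠ 0 := by
  rcases j with j | j
  · have : (W.mult j : ℝ) ≠ 0 := by have := hmult j; positivity
    simp [coef, repIndicator, this]
  · simp [coef, repIndicator]

theorem coef_ne_zero {W : Collections α ℓ s} (hmult : ∀ i, 2 ≤ W.mult i)
    (j : Fin ℓ ⊕ Fin s) : W.coef j ≠ 0 := by
  rcases j with j | j
  · have h : (1 : ℝ) < W.mult j := by exact_mod_cast hmult j
    have h' : 1 / (W.mult j : ℝ) < 1 := by rw [div_lt_one (by linarith)]; exact h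
    simpa [coef] using (sub_pos.2 h').ne'
  · simp [coef]

section

variable [DecidableEq α]

/-- The part of the correlation polynomial that comes from proper overlaps. -/
noncomputable def overlapPoly (W : Collections α ℓ s) (i j : Fin ℓ ⊕ Fin s) : ℝ[X] :=
  ∑ t ∈ Finset.range ((W.word i).length - 1),
    if (W.word i).take (t + 1) <:+ W.word j then X ^ t else 0

theorem corrPoly_word {W : Collections α ℓ s} (hred : W.IsReduced) (hne : ∀ i, W.word i ≠ [])
    (i j : Fin ℓ ⊕ Fin s) :
    corrPoly (W.word j) (W.word i) =
      W.overlapPoly i j + if i = j then X ^ ((W.word i).length - 1) else 0 := by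
  have hv : 0 < (W.word i).length := List.length_pos_iff.2 (hne i)
  have hu : 0 < (W.word j).length := List.length_pos_iff.2 (hne j)
  -- Here t + 1 is the length of the end of w_j that lies above w_i. If t + 1 ≥ |w_i|, a match puts
  -- all of w_i inside w_j, which reducedness permits only for i = j.
  have hterm : ∀ t ∈ Finset.range (W.word j).length,
      (if ((W.word j).drop ((W.word j).length - 1 - t)).take (W.word i).length =
          (W.word i).take ((W.word j).drop ((W.word j).length - 1 - t)).length
        then (X : ℝ[X]) ^ ((W.word j).length - 1 - ((W.word j).length - 1 - t)) else 0) =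
      (if t < (W.word i).length - 1 then if (W.word i).take (t + 1) <:+ (W.word j) then X ^ t else 0 else 0) +
        if t = (W.word i).length - 1 then (if i = j then X ^ t else 0) else 0 := by
    intro t ht
    have ht := Finset.mem_range.1 ht
    have hlen : ((W.word j).drop ((W.word j).length - 1 - t)).length = t + 1 := by
      rw [List.length_drop]; omega
    have hexp : (W.word j).length - 1 - ((W.word j).length - 1 - t) = t := by omega
    rw [hlen, hexp]
    by_cases htv : t < (W.word i).length - 1
    · rw [if_pos htv, if_neg htv.ne, add_zero, List.take_of_length_le (by omega)]
      have : (W.word j).drop ((W.word j).length - 1 - t) = (W.word i).take (t + 1) ↔ (W.word i).take (t + 1) <:+ (W.word j) := by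
        rw [List.suffix_iff_eq_drop, List.length_take, min_eq_left (by omega),
          show (W.word j).length - (t + 1) = (W.word j).length - 1 - t by omega, eq_comm]
      simp only [this]
    · rw [if_neg htv, zero_add, List.take_of_length_le (l := W.word i) (by omega)]
      by_cases hij : i = j
      · subst hij
        have htv' : t = (W.word i).length - 1 := by omega
        rw [if_pos htv', if_pos rfl, List.take_of_length_le (by omega), if_pos]
        rw [htv', Nat.sub_self, List.drop_zero]
      · rw [if_neg hij, ite_self, if_neg]
        intro h
        apply hred i j hij
        rw [← h]
        exact (List.take_prefix _ _).isInfix.trans (List.drop_suffix _ _).isInfix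
  rw [corrPoly, ← Finset.sum_range_reflect, Finset.sum_congr rfl hterm, Finset.sum_add_distrib]
  congr 1
  · rw [← Finset.sum_filter]
    refine Finset.sum_subset (fun t ht => ?_) fun t ht ht' => if_neg fun h => ?_
    · exact Finset.mem_range.2 (Finset.mem_filter.1 ht).2
    · simp only [Finset.mem_filter, Finset.mem_range, not_and] at ht ht'
      have := h.length_le
      rw [List.length_take, min_eq_left (by omega)] at this
      exact ht' this ht
  · rw [Finset.sum_ite_eq']
    by_cases hij : i = j
    · subst hij
      rw [if_pos (Finset.mem_range.2 (by omega))]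
    · simp [hij]

/-- An overlap as long as w_j would make w_j a proper prefix of w_i, against reducedness. -/
theorem degree_X_mul_overlapPoly_lt {W : Collections α ℓ s} (hred : W.IsReduced)
    (i j : Fin ℓ ⊕ Fin s) :
    (X * W.overlapPoly i j).degree < ((W.word j).length : WithBot ℕ) := by
  rw [overlapPoly, Finset.mul_sum]
  refine (degree_sum_le _ _).trans_lt ((Finset.sup_lt_iff (WithBot.bot_lt_coe _)).2 fun t ht => ?_)
  split_ifs with h
  · rw [← pow_succ', degree_X_pow]
    have ht := Finset.mem_range.1 ht
    have hlen := h.length_le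
    rw [List.length_take, min_eq_left (by omega)] at hlen
    refine Nat.cast_lt.2 (lt_of_le_of_ne hlen fun heq => ?_)
    have heq' : (W.word i).take (t + 1) = W.word j :=
      h.eq_of_length (by rw [List.length_take, min_eq_left (by omega), heq])
    have hinf : W.word j <:+: W.word i := heq' ▸ (List.take_prefix _ _).isInfix
    by_cases hij : j = i
    · subst hij; omega
    · exact hred j i hij hinf
  · simp

/-- The matrix `P(z)` over the polynomials. -/
noncomputable def polyP (W : Collections α ℓ s) :
    Matrix (Fin ℓ ⊕ Fin s) (Fin ℓ ⊕ Fin s) ℝ[X] :=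
  Matrix.of fun i j => X * C (W.coef j) * corrPoly (W.word j) (W.word i) -
    if i = j then C (repIndicator j) * X ^ (W.word j).length else 0

theorem map_polyP (W : Collections α ℓ s) :
    W.polyP.map (algebraMap ℝ[X] (RatFunc ℝ)) = W.matrixP := by
  ext i j
  rcases i with i | i <;> rcases j with j | j <;>
    simp [matrixP, polyP, coef, repIndicator, word]
  · split_ifs <;> simp <;> exact Or.inl (mul_comm _ _)
  · exact Or.inl (mul_comm _ _)

theorem polyP_apply {W : Collections α ℓ s} (hred : W.IsReduced) (hne : ∀ i, W.word i ≠ [])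
    (i j : Fin ℓ ⊕ Fin s) :
    W.polyP i j = C (W.coef j) * (X * W.overlapPoly i j) +
      if i = j then C (W.coef j - repIndicator j) * X ^ (W.word j).length else 0 := by
  rw [polyP, Matrix.of_apply, corrPoly_word hred hne]
  by_cases hij : i = j
  · subst hij
    have : (X : ℝ[X]) ^ (W.word i).length = X * X ^ ((W.word i).length - 1) := by
      rw [← pow_succ', Nat.sub_add_cancel (List.length_pos_iff.2 (hne i))]
    simp only [if_true, this, C_sub]
    ring
  · simp only [hij, if_false]
    ring

theorem degree_polyP_lt {W : Collections α ℓ s} (hred : W.IsReduced) (hne : ∀ i, W.word i ≠ [])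
    {i j : Fin ℓ ⊕ Fin s} (hij : i ≠ j) :
    (W.polyP i j).degree < ((W.word j).length : WithBot ℕ) := by
  rw [polyP_apply hred hne, if_neg hij, add_zero]
  exact (smul_eq_C_mul (R := ℝ) _ ▸ degree_smul_le _ _).trans_lt (degree_X_mul_overlapPoly_lt hred i j)

theorem degree_polyP_diag {W : Collections α ℓ s} (hred : W.IsReduced)
    (hne : ∀ i, W.word i ≠ []) (hmult : ∀ i, 2 ≤ W.mult i) (j : Fin ℓ ⊕ Fin s) :
    (W.polyP j j).degree = ((W.word j).length : WithBot ℕ) := by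
  rw [polyP_apply hred hne, if_pos rfl]
  have h := degree_C_mul_X_pow (W.word j).length (coef_sub_repIndicator_ne_zero hmult j)
  rw [degree_add_eq_right_of_degree_lt, h]
  rw [h]
  exact (smul_eq_C_mul (R := ℝ) _ ▸ degree_smul_le _ _).trans_lt (degree_X_mul_overlapPoly_lt hred j j)

/-- In column j the diagonal entry has degree exactly |w_j| and the others smaller degree. At a
large real point the matrix is therefore strictly diagonally dominant by columns. -/
theorem det_polyP_ne_zero {W : Collections α ℓ s} (hred : W.IsReduced)
    (hne : ∀ i, W.word i ≠ []) (hmult : ∀ i, 2 ≤ W.mult i) : W.polyP.det ≠ 0 := by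
  have hdom : ∀ j, ∀ᶠ x : ℝ in Filter.atTop,
      ∑ i ∈ Finset.univ.erase j, ‖(W.polyP i j).eval x‖ < ‖(W.polyP j j).eval x‖ := by
    intro j
    have h1 : (fun x : ℝ => ∑ i ∈ Finset.univ.erase j, ‖(W.polyP i j).eval x‖)
        =o[Filter.atTop] fun x => (W.polyP j j).eval x := by
      refine Asymptotics.IsLittleO.fun_sum fun i hi => (isLittleO_atTop_of_degree_lt _ _ ?_).norm_left
      rw [degree_polyP_diag hred hne hmult]
      exact degree_polyP_lt hred hne (Finset.ne_of_mem_erase hi)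
    have h0 : W.polyP j j ≠ 0 := by
      intro h0
      have := degree_polyP_diag hred hne hmult j
      simp [h0] at this
    filter_upwards [h1.def (c := 1 / 2) (by norm_num),
      (W.polyP j j).eventually_atTop_not_isRoot h0] with x hx hx0
    have hx0 : 0 < ‖(W.polyP j j).eval x‖ := norm_pos_iff.2 hx0
    have := (le_abs_self _).trans hx
    linarith
  obtain ⟨x, hx⟩ := (Filter.eventually_all.2 hdom).exists
  intro h
  have h2 := det_ne_zero_of_sum_col_lt_diag (A := W.polyP.map (Polynomial.evalRingHom x)) hx
  rw [← RingHom.mapMatrix_apply, ← RingHom.map_det, h, map_zero] at h2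
  exact h2 rfl

end

end Collections
end RepeatedWords

/-! ### Shifting a series in 1/x -/

theorem hasSum_invSeries_shift {c : ℕ → ℝ} {x : ℝ} (hx : x ≠ 0)
    (hc : Summable fun n => c n * (x⁻¹) ^ n) {k : ℕ} (hk : ∀ n < k, c n = 0) :
    HasSum (fun n => c (n + k) * (x⁻¹) ^ n) (x ^ k * invSeries c x) := by
  have h := (hasSum_nat_add_iff' k).2 hc.hasSum
  rw [Finset.sum_eq_zero (fun n hn => by rw [hk n (Finset.mem_range.1 hn), zero_mul]),
    sub_zero] at h
  refine (h.mul_left (x ^ k)).congr_fun fun n => ?_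
  rw [pow_add, inv_pow x k]
  field_simp

namespace RepeatedWords
variable {α : Type*} {ℓ s : ℕ}

namespace Collections

open Polynomial

theorem eval_overlapPoly [DecidableEq α] (W : Collections α ℓ s) (i j : Fin ℓ ⊕ Fin s) (x : ℝ) :
    (W.overlapPoly i j).eval x = ∑ t ∈ Finset.range ((W.word i).length - 1),
      if (W.word i).take (t + 1) <:+ W.word j then x ^ t else 0 := by
  rw [overlapPoly, eval_finsetSum]
  exact Finset.sum_congr rfl fun t _ => by split_ifs <;> simp

theorem combination_eq_sum [Fintype α] (W : Collections α ℓ s) (T : Fin ℓ ⊕ Fin s → RatFunc ℝ) :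
    W.combination T = RatFunc.X - RatFunc.C (Fintype.card α : ℝ) +
      ∑ i, RatFunc.X * RatFunc.C (W.coef i) * T i := by
  rw [combination, Fintype.sum_sum_type, Finset.mul_sum, Finset.mul_sum]
  simp only [coef, Sum.elim_inl, Sum.elim_inr, map_neg, map_one, mul_neg, mul_one, neg_mul,
    Finset.sum_neg_distrib, mul_assoc]
  ring

section

variable [Fintype α] [DecidableEq α]

/-! ### The linear system for the generating functions -/

theorem summable_endingWeight (W : Collections α ℓ s) {x : ℝ} (hx : 0 < x)
    (hs : Summable fun n => W.totalWeight n * (x⁻¹) ^ n) (i : Fin ℓ ⊕ Fin s) :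
    Summable fun n => W.endingWeight i n * (x⁻¹) ^ n := by
  rw [← summable_nat_add_iff 1]
  refine Summable.of_nonneg_of_le
    (fun n => mul_nonneg (W.endingWeight_nonneg i _) (by positivity)) (fun n => ?_)
    (hs.mul_left (Fintype.card α * x⁻¹))
  calc W.endingWeight i (n + 1) * x⁻¹ ^ (n + 1)
      ≤ (Fintype.card α * W.totalWeight n) * x⁻¹ ^ (n + 1) :=
        mul_le_mul_of_nonneg_right (W.endingWeight_succ_le i n) (by positivity)
    _ = _ := by ring

theorem invSeries_totalWeight {W : Collections α ℓ s} (hred : W.IsReduced)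
    (hne : ∀ i, W.word i ≠ []) {x : ℝ} (hx : 0 < x)
    (hs : Summable fun n => W.totalWeight n * (x⁻¹) ^ n) :
    (x - Fintype.card α) * invSeries W.totalWeight x -
      x * ∑ i, (W.factor i - 1) * invSeries (W.endingWeight i) x = x := by
  have h1 : HasSum (fun n => W.totalWeight (n + 1) * (x⁻¹) ^ n)
      (x * (invSeries W.totalWeight x - 1)) := by
    have h := (hasSum_nat_add_iff' 1).2 hs.hasSum
    simp only [Finset.range_one, Finset.sum_singleton, totalWeight_zero, pow_zero, mul_one] at h
    refine (h.mul_left x).congr_fun fun n => ?_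
    rw [pow_succ]
    field_simp
  have h2 : HasSum (fun n => W.totalWeight (n + 1) * (x⁻¹) ^ n)
      (Fintype.card α * invSeries W.totalWeight x +
        ∑ i, (W.factor i - 1) * (x ^ 1 * invSeries (W.endingWeight i) x)) := by
    refine ((hs.hasSum.mul_left _).add (hasSum_sum fun i _ =>
      (hasSum_invSeries_shift hx.ne' (W.summable_endingWeight hx hs i) (k := 1)
        (fun n hn => W.endingWeight_of_lt (i := i)
          (hn.trans_le (List.length_pos_iff.2 (hne i))))).mul_left
            (W.factor i - 1))).congr_fun fun n => ?_
    rw [totalWeight_succ hred hne, add_mul, Finset.sum_mul]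
    simp only [mul_assoc]
  have h := h1.unique h2
  simp only [pow_one, mul_left_comm _ x, ← Finset.mul_sum] at h
  linear_combination h

theorem invSeries_endingWeight {W : Collections α ℓ s} (hred : W.IsReduced)
    (hne : ∀ i, W.word i ≠ []) {x : ℝ} (hx : 0 < x)
    (hs : Summable fun n => W.totalWeight n * (x⁻¹) ^ n) (i : Fin ℓ ⊕ Fin s) :
    x ^ (W.word i).length * invSeries (W.endingWeight i) x = invSeries W.totalWeight x +
      ∑ j, (W.factor j - 1) * (x * (W.overlapPoly i j).eval x * invSeries (W.endingWeight j) x) := by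
  have hsum := W.summable_endingWeight hx hs
  have h1 := hasSum_invSeries_shift hx.ne' (hsum i) (k := (W.word i).length)
    (fun n hn => W.endingWeight_of_lt hn)
  have h2 : ∀ j, ∀ t ∈ Finset.range ((W.word i).length - 1),
      HasSum (fun n => (if (W.word i).take (t + 1) <:+ W.word j
          then W.endingWeight j (n + (t + 1)) else 0) * (x⁻¹) ^ n)
        ((if (W.word i).take (t + 1) <:+ W.word j then x ^ t else 0) *
          (x * invSeries (W.endingWeight j) x)) := by
    intro j t ht
    split_ifs with h
    · rw [← mul_assoc, ← pow_succ]
      refine hasSum_invSeries_shift hx.ne' (hsum j) fun n hn => W.endingWeight_of_lt ?_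
      have hlen := h.length_le
      rw [List.length_take] at hlen
      have := Finset.mem_range.1 ht
      omega
    · simp
  have h3 := hs.hasSum.add (hasSum_sum fun j (_ : j ∈ Finset.univ) =>
    (hasSum_sum (h2 j)).mul_left (W.factor j - 1))
  have h4 := h1.unique (h3.congr_fun fun n => by
    rw [endingWeight_add hred hne, add_mul, Finset.sum_mul]
    simp only [mul_assoc, Finset.sum_mul])
  rw [h4]
  simp only [eval_overlapPoly, ← Finset.sum_mul]
  congr 1
  refine Finset.sum_congr rfl fun j _ => ?_
  ring

/-- The overlap terms of `invSeries_endingWeight` give the overlap part of P. On the diagonal, the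
full overlap and the term with ε_ii combine, since coef · scale - repIndicator · scale = -1. -/
theorem evalP_mulVec {W : Collections α ℓ s} (hred : W.IsReduced) (hne : ∀ i, W.word i ≠ [])
    (hmult : ∀ i, 2 ≤ W.mult i) {x : ℝ} (hx : 0 < x)
    (hs : Summable fun n => W.totalWeight n * (x⁻¹) ^ n) :
    (W.polyP.map (Polynomial.eval x)).mulVec
        (fun j => W.scale j * invSeries (W.endingWeight j) x) =
      fun _ => -invSeries W.totalWeight x := by
  funext i
  have h := invSeries_endingWeight hred hne hx hs i
  have h1 : ∀ j, (W.polyP i j).eval x * (W.scale j * invSeries (W.endingWeight j) x) =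
      (W.factor j - 1) * (x * (W.overlapPoly i j).eval x * invSeries (W.endingWeight j) x) -
        if i = j then x ^ (W.word j).length * invSeries (W.endingWeight j) x else 0 := by
    intro j
    rw [polyP_apply hred hne]
    have h2 := coef_mul_scale hmult j
    have h3 := W.repIndicator_mul_scale j
    split_ifs with hij
    · simp only [eval_add, eval_mul, eval_C, eval_X, eval_pow]
      linear_combination (x * (W.overlapPoly i j).eval x * invSeries (W.endingWeight j) x +
        x ^ (W.word j).length * invSeries (W.endingWeight j) x) * h2 -
        (x ^ (W.word j).length * invSeries (W.endingWeight j) x) * h3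
    · simp only [eval_add, eval_mul, eval_C, eval_X, eval_zero]
      linear_combination (x * (W.overlapPoly i j).eval x * invSeries (W.endingWeight j) x) * h2
  simp only [Matrix.mulVec, dotProduct, Matrix.map_apply, h1, Finset.sum_sub_distrib,
    Finset.sum_ite_eq, Finset.mem_univ, if_true]
  linear_combination -h

/-! ### The combination of row sums as a quotient of polynomials -/

/-- The numerator of `W.combination W.rowSumP` over the denominator `det P(z)`. -/
noncomputable def combPoly (W : Collections α ℓ s) : ℝ[X] :=
  (X - C (Fintype.card α : ℝ)) * W.polyP.det +
    ∑ i, X * C (W.coef i) * ∑ j, W.polyP.adjugate i j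

theorem combination_mul_det {W : Collections α ℓ s} (hdet : W.polyP.det ≠ 0) :
    W.combination W.rowSumP * algebraMap ℝ[X] (RatFunc ℝ) W.polyP.det =
      algebraMap ℝ[X] (RatFunc ℝ) W.combPoly := by
  have hP := W.map_polyP
  rw [← RingHom.mapMatrix_apply] at hP
  have hd : W.matrixP.det = algebraMap ℝ[X] (RatFunc ℝ) W.polyP.det := by
    rw [← hP, RingHom.map_det]
  have hd0 : W.matrixP.det ≠ 0 := by
    rw [hd]
    simpa using hdet
  have hinv : ∀ i j, W.matrixP⁻¹ i j * W.matrixP.det =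
      algebraMap ℝ[X] (RatFunc ℝ) (W.polyP.adjugate i j) := by
    intro i j
    rw [Matrix.inv_def, Matrix.smul_apply, Ring.inverse_eq_inv', smul_eq_mul, mul_comm,
      ← mul_assoc, mul_inv_cancel₀ hd0, one_mul, ← hP, ← RingHom.map_adjugate]
    rfl
  rw [combination_eq_sum, combPoly, map_add, map_mul, map_sub, ← hd, RatFunc.algebraMap_X,
    RatFunc.algebraMap_C, add_mul, Finset.sum_mul, map_sum]
  congr 1
  refine Finset.sum_congr rfl fun i _ => ?_
  rw [map_mul, map_mul, RatFunc.algebraMap_X, RatFunc.algebraMap_C, map_sum, mul_assoc, rowSumP,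
    Finset.sum_mul]
  simp only [hinv]

/-- Multiplying P T = -G · 1 by the adjugate gives det P · T_i = -G · (row sum of adj P).
Substituting this into the equation for G turns the combination into z / G, without requiring det
P(x) ≠ 0. -/
theorem invSeries_mul_combPoly {W : Collections α ℓ s} (hred : W.IsReduced)
    (hne : ∀ i, W.word i ≠ []) (hmult : ∀ i, 2 ≤ W.mult i) {x : ℝ} (hx : 0 < x)
    (hs : Summable fun n => W.totalWeight n * (x⁻¹) ^ n) :
    invSeries W.totalWeight x * W.combPoly.eval x = x * W.polyP.det.eval x := by
  set G := invSeries W.totalWeight x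
  set T : Fin ℓ ⊕ Fin s → ℝ := fun j => W.scale j * invSeries (W.endingWeight j) x with hT
  have h1 : (W.polyP.map (Polynomial.eval x)).mulVec T = fun _ => -G :=
    evalP_mulVec hred hne hmult hx hs
  have hM : W.polyP.map (Polynomial.eval x) = (evalRingHom x).mapMatrix W.polyP := rfl
  have h2 : ∀ i, W.polyP.det.eval x * T i = -G * ∑ j, (W.polyP.adjugate i j).eval x := by
    intro i
    have h := congrArg (fun v => ((W.polyP.map (Polynomial.eval x)).adjugate.mulVec v) i) h1
    simp only [Matrix.mulVec_mulVec, Matrix.adjugate_mul, Matrix.smul_mulVec,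
      Matrix.one_mulVec] at h
    rw [hM, ← RingHom.map_det, ← RingHom.map_adjugate] at h
    simp only [coe_evalRingHom, Pi.smul_apply, smul_eq_mul] at h
    rw [h, Matrix.mulVec, dotProduct, ← Finset.sum_mul, mul_comm]
    rfl
  have h3 := invSeries_totalWeight hred hne hx hs
  have h4 : ∀ i, G * (x * W.coef i * ∑ j, (W.polyP.adjugate i j).eval x) =
      -(W.polyP.det.eval x * (x * ((W.factor i - 1) * invSeries (W.endingWeight i) x))) := by
    intro i
    have := h2 i
    have h5 := coef_mul_scale hmult i
    simp only [hT] at this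
    linear_combination (x * W.coef i) * this +
      (-x * W.polyP.det.eval x * invSeries (W.endingWeight i) x) * h5
  rw [combPoly, eval_add, eval_finsetSum, mul_add, Finset.mul_sum]
  simp only [eval_mul, eval_sub, eval_X, eval_C, eval_finsetSum, h4, Finset.sum_neg_distrib,
    ← Finset.mul_sum]
  linear_combination (W.polyP.det.eval x) * h3

/-! ### Equality of the combinations for P and Q -/

theorem combination_rowSumP_eq_rowSumQ {W : Collections α ℓ s} (hmult : ∀ i, 2 ≤ W.mult i) :
    W.combination W.rowSumP = W.combination W.rowSumQ := by
  set d : Fin ℓ ⊕ Fin s → RatFunc ℝ := fun i => RatFunc.X * RatFunc.C (W.coef i) with hd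
  have hD : W.matrixD = Matrix.diagonal d := by
    rw [matrixD]
    congr 1
    funext i
    rcases i with i | i <;> simp [hd, coef]
  have hd0 : ∀ i, d i ≠ 0 := fun i => mul_ne_zero RatFunc.X_ne_zero
    ((_root_.map_ne_zero _).2 (coef_ne_zero hmult i))
  have hDinv : W.matrixD⁻¹ = Matrix.diagonal d⁻¹ := by
    rw [hD]
    refine Matrix.inv_eq_right_inv ?_
    rw [Matrix.diagonal_mul_diagonal, ← Matrix.diagonal_one]
    congr 1
    funext i
    exact mul_inv_cancel₀ (hd0 i)
  have hDD : W.matrixD⁻¹⁻¹ = W.matrixD := by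
    refine Matrix.nonsing_inv_nonsing_inv _ ?_
    rw [hD, Matrix.det_diagonal, isUnit_iff_ne_zero]
    exact Finset.prod_ne_zero_iff.2 fun i _ => hd0 i
  -- Since Q⁻¹ = D⁻¹ (P⁻¹)ᵀ D, the weight d_i cancels its inverse in ∑ d_i (Q⁻¹)_ij, leaving the
  -- double sum for P with i and j exchanged.
  have hQ : ∀ i j, W.matrixQ⁻¹ i j = (d i)⁻¹ * W.matrixP⁻¹ j i * d j := by
    intro i j
    rw [matrixQ, Matrix.mul_inv_rev, Matrix.mul_inv_rev, hDD, ← mul_assoc,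
      ← Matrix.transpose_nonsing_inv, hDinv, hD, Matrix.mul_diagonal, Matrix.diagonal_mul]
    rfl
  have key : ∀ a b c : RatFunc ℝ, a ≠ 0 → b * c = a * (a⁻¹ * c * b) := by
    intro a b c ha
    rw [mul_assoc, mul_inv_cancel_left₀ ha, mul_comm]
  rw [combination_eq_sum, combination_eq_sum]
  congr 1
  simp only [rowSumP, rowSumQ, Finset.mul_sum, hQ]
  rw [Finset.sum_comm]
  refine Finset.sum_congr rfl fun i _ => Finset.sum_congr rfl fun j _ => ?_
  exact key _ _ _ (hd0 i)

end

end Collections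
end RepeatedWords

namespace RepeatedWords
variable {α : Type*} {ℓ s : ℕ}

/-! ### Blocks of sequences -/

@[simp]
theorem length_block (x : ℕ → α) (k n : ℕ) : (block x k n).length = n := by
  simp [block]

theorem block_add (x : ℕ → α) (k a b : ℕ) :
    block x k (a + b) = block x k a ++ block x (k + a) b := by
  simp [block, List.range_add, add_assoc, Function.comp_def]

theorem block_comp_add (x : ℕ → α) (c k n : ℕ) :
    block (fun t => x (c + t)) k n = block x (c + k) n := by
  simp [block, add_assoc]

theorem block_infix (x : ℕ → α) (k n : ℕ) : block x k n <:+: block x 0 (k + n) := by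
  rw [block_add, zero_add]
  exact (List.suffix_append _ _).isInfix

theorem eq_block_of_append_eq {x : ℕ → α} {k n : ℕ} {a b : List α} (h : a ++ b = block x k n) :
    a = block x k a.length ∧ b = block x (k + a.length) b.length := by
  have hn : n = a.length + b.length := by
    rw [← List.length_append, h, length_block]
  subst hn
  rw [block_add] at h
  exact List.append_inj h (by simp)

theorem take_block (x : ℕ → α) (k : ℕ) {n m : ℕ} (h : m ≤ n) :
    (block x k n).take m = block x k m := by
  obtain ⟨c, rfl⟩ := Nat.exists_eq_add_of_le h
  rw [block_add, List.take_left' (by simp)]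

namespace Collections

/-! ### Allowed words -/

/-- The word contains no forbidden word. -/
def Avoids (W : Collections α ℓ s) (w : List α) : Prop :=
  ∀ j, ¬ W.forb j <:+: w

theorem Avoids.of_infix {W : Collections α ℓ s} {u w : List α} (h : W.Avoids w) (hu : u <:+: w) :
    W.Avoids u :=
  fun j hj => h j (hj.trans hu)

theorem mem_shift_iff {W : Collections α ℓ s} {x : ℕ → α} :
    x ∈ W.shift ↔ ∀ n, W.Avoids (block x 0 n) := by
  constructor
  · rintro hx n j ⟨u, v, h⟩
    rw [List.append_assoc] at h
    have h1 := (eq_block_of_append_eq h).2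
    exact hx j _ (eq_block_of_append_eq h1).1.symm
  · intro h j k hjk
    exact h _ j (hjk ▸ block_infix x k _)

theorem shift_comp_add {W : Collections α ℓ s} {x : ℕ → α} (hx : x ∈ W.shift) (c : ℕ) :
    (fun t => x (c + t)) ∈ W.shift := fun j k => by
  rw [block_comp_add]
  exact hx j _

theorem allowed_iff {W : Collections α ℓ s} {w : List α} :
    W.Allowed w ↔ ∃ x ∈ W.shift, block x 0 w.length = w := by
  constructor
  · rintro ⟨x, hx, k, h⟩
    exact ⟨_, shift_comp_add hx k, by rw [block_comp_add]; exact h⟩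
  · rintro ⟨x, hx, h⟩
    exact ⟨x, hx, 0, h⟩

theorem Allowed.of_infix {W : Collections α ℓ s} {u w : List α} (h : W.Allowed w)
    (hu : u <:+: w) : W.Allowed u := by
  obtain ⟨x, hx, k, hw⟩ := h
  obtain ⟨a, b, rfl⟩ := hu
  rw [List.append_assoc] at hw
  have h1 := (eq_block_of_append_eq hw.symm).2
  exact ⟨x, hx, _, (eq_block_of_append_eq h1).1.symm⟩

theorem Allowed.avoids {W : Collections α ℓ s} {w : List α} (h : W.Allowed w) : W.Avoids w := by
  obtain ⟨x, hx, hw⟩ := allowed_iff.1 h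
  exact hw ▸ mem_shift_iff.1 hx _

theorem length_word_le (W : Collections α ℓ s) (i : Fin ℓ ⊕ Fin s) :
    (W.word i).length ≤ W.maxLength :=
  Finset.le_sup (f := fun i => (W.word i).length) (Finset.mem_univ i)

/-- An allowed word can be extended to the left whenever the new prefix is allowed. -/
theorem Allowed.cons {W : Collections α ℓ s} {w : List α} {a : α} (h : W.Allowed w)
    (hlen : W.maxLength ≤ w.length + 1) (ha : W.Allowed ((a :: w).take W.maxLength)) :
    W.Allowed (a :: w) := by
  obtain ⟨y, hy, hw⟩ := allowed_iff.1 h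
  let z : ℕ → α := fun t => Nat.casesOn t a y
  have hz : ∀ n, block z 0 (n + 1) = a :: block y 0 n := by
    intro n
    simp [block, List.range_succ_eq_map, z, Function.comp_def]
  have hzy : ∀ k n, block z (k + 1) n = block y k n := by
    intro k n
    simp only [block]
    refine List.map_congr_left fun t _ => ?_
    rw [add_right_comm]
  have hzw : block z 0 (a :: w).length = a :: w := by
    rw [List.length_cons, hz, hw]
  refine allowed_iff.2 ⟨z, ?_, hzw⟩
  intro j k hjk
  cases k with
  | zero =>
    refine ha.avoids j ?_
    have hj : (W.forb j).length ≤ W.maxLength := W.length_word_le (Sum.inr j)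
    rw [← hjk, ← hzw, take_block _ _ (by simpa using hlen), ← take_block z 0 hj]
    exact (List.take_prefix _ _).isInfix
  | succ k => exact hy j k (by rw [← hzy]; exact hjk)

/-! ### Extendable words -/

/-- Words avoiding the forbidden words that have arbitrarily long extensions to the right. -/
def Extendable (W : Collections α ℓ s) (u : List α) : Prop :=
  ∀ n, ∃ v : List α, v.length = n ∧ W.Avoids (u ++ v)

/-- Pigeonhole: if each symbol x failed at some length n x, an extension longer than all of these
would start with some x and contradict its failure. -/
theorem Extendable.exists_concat [Finite α] {W : Collections α ℓ s} {u : List α}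
    (h : W.Extendable u) : ∃ x, W.Extendable (u ++ [x]) := by
  by_contra! hx
  simp only [Extendable, not_forall] at hx
  choose n hn using hx
  obtain ⟨M, hM⟩ := (Set.finite_range n).bddAbove
  obtain ⟨v, hv, hav⟩ := h (M + 1)
  cases v with
  | nil => simp at hv
  | cons x v =>
    have hnx : n x ≤ v.length := by
      have := hM (Set.mem_range_self x)
      simp only [List.length_cons] at hv
      omega
    refine hn x ⟨v.take (n x), by simp [hnx], hav.of_infix ?_⟩
    refine List.IsPrefix.isInfix ?_
    rw [List.append_assoc, List.prefix_append_right_inj]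
    exact List.prefix_append_right_inj [x] |>.2 (List.take_prefix _ _)

/-- By compactness, words with arbitrarily long extensions occur in the subshift. -/
theorem Extendable.allowed [Finite α] {W : Collections α ℓ s} {u : List α} (h : W.Extendable u) :
    W.Allowed u := by
  obtain ⟨x₀, _⟩ := h.exists_concat
  have : Nonempty α := ⟨x₀⟩
  choose! next hnext using fun v (hv : W.Extendable v) => hv.exists_concat
  -- König's argument: the nested extendable words `L k` converge to a sequence, each of whose
  -- initial blocks is a prefix of some `L k`.
  let L : ℕ → List α := fun k => Nat.rec u (fun _ v => v ++ [next v]) k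
  have hL : ∀ k, W.Extendable (L k) := by
    intro k
    induction k with
    | zero => exact h
    | succ k ih => exact hnext _ ih
  have hlen : ∀ k, (L k).length = u.length + k := by
    intro k
    induction k with
    | zero => rfl
    | succ k ih =>
      change (L k ++ [next (L k)]).length = _
      rw [List.length_append, ih]
      rfl
  have hpre : ∀ k m, L k <+: L (k + m) := by
    intro k m
    induction m with
    | zero => exact List.prefix_rfl
    | succ m ih => exact ih.trans (List.prefix_append _ _)
  have hlt : ∀ t, t < (L (t + 1)).length := fun t => by
    have := hlen (t + 1)
    omega
  let y : ℕ → α := fun t => (L (t + 1))[t]'(hlt t)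
  have hy : ∀ k, block y 0 (L k).length = L k := by
    intro k
    refine List.ext_getElem (by simp) fun t h1 h2 => ?_
    have h3 : y t = (L k)[t] := by
      rcases le_total k (t + 1) with hk | hk
      · obtain ⟨m, hm⟩ := Nat.exists_eq_add_of_le hk
        have := hpre k m
        rw [← hm] at this
        exact (this.getElem h2).symm
      · obtain ⟨m, rfl⟩ := Nat.exists_eq_add_of_le hk
        exact (hpre (t + 1) m).getElem (hlt t)
    rw [← h3]
    simp [block]
  refine allowed_iff.2 ⟨y, mem_shift_iff.2 fun n => ?_, hy 0⟩
  obtain ⟨v, hv, hav⟩ := hL n 0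
  rw [List.length_eq_zero_iff.1 hv, List.append_nil] at hav
  refine hav.of_infix ?_
  rw [← hy n, ← take_block y 0 (show n ≤ (L n).length from (hlen n).symm ▸ Nat.le_add_left _ _)]
  exact (List.take_prefix _ _).isInfix

/-- A forbidden word has length at most |e| + 1. If it starts inside u it therefore ends inside u ++
e; otherwise it lies in e ++ v. -/
theorem Avoids.append_append {W : Collections α ℓ s} {u e v : List α}
    (he : W.maxLength ≤ e.length + 1) (h1 : W.Avoids (u ++ e)) (h2 : W.Avoids (e ++ v)) :
    W.Avoids (u ++ (e ++ v)) := by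
  rintro j ⟨a, b, h⟩
  have hj : (W.forb j).length ≤ e.length + 1 := (W.length_word_le (Sum.inr j)).trans he
  rcases le_or_gt u.length a.length with hl | hl
  · rw [List.append_assoc] at h
    obtain ⟨c, rfl⟩ : u <+: a := List.prefix_of_prefix_length_le (l₃ := u ++ (e ++ v))
      (List.prefix_append _ _) (h ▸ List.prefix_append _ _) hl
    rw [List.append_assoc, List.append_cancel_left_eq] at h
    exact h2 j ⟨c, b, by rw [List.append_assoc]; exact h⟩
  · rw [← List.append_assoc u] at h
    have hpre : a ++ W.forb j <+: u ++ e := by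
      refine List.prefix_of_prefix_length_le (l₃ := u ++ e ++ v) ⟨b, h⟩ (List.prefix_append _ _) ?_
      simp only [List.length_append]
      omega
    exact h1 j ((List.suffix_append a _).isInfix.trans hpre.isInfix)

/-- There is a uniform bound on the extensions of long words that are not allowed. -/
theorem exists_extension_bound [Fintype α] (W : Collections α ℓ s) :
    ∃ N : ℕ, ∀ u v : List α, W.maxLength ≤ u.length + 1 → v.length = N → W.Avoids (u ++ v) →
      W.Allowed u := by
  have h : ∀ e : List α, ∃ n, ¬ W.Extendable e → ∀ v : List α, v.length = n →
      ¬ W.Avoids (e ++ v) := by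
    intro e
    by_cases he : W.Extendable e
    · exact ⟨0, fun h => absurd he h⟩
    · simp only [Extendable, not_forall, not_exists, not_and] at he
      obtain ⟨n, hn⟩ := he
      exact ⟨n, fun _ => hn⟩
  choose n hn using h
  -- Whether u extends depends only on its last p - 1 symbols `e`. There are finitely many such e,
  -- so the largest failing length serves for all.
  refine ⟨(words α (W.maxLength - 1)).sup n, fun u v hu hv huv => Extendable.allowed ?_⟩
  obtain ⟨a, e, rfl, he⟩ : ∃ a e : List α, a ++ e = u ∧ e.length = W.maxLength - 1 :=
    ⟨u.take (u.length - (W.maxLength - 1)), u.drop (u.length - (W.maxLength - 1)),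
      List.take_append_drop _ _, by rw [List.length_drop]; omega⟩
  have hext : W.Extendable e := by
    by_contra hne
    have hle : n e ≤ v.length := hv ▸ Finset.le_sup (mem_words.2 he)
    refine hn e hne (v.take (n e)) (by simp [hle]) (huv.of_infix ?_)
    rw [List.append_assoc]
    refine List.IsInfix.trans ?_ (List.suffix_append a _).isInfix
    exact ((List.prefix_append_right_inj e).2 (List.take_prefix _ _)).isInfix
  intro m
  obtain ⟨v', hv', hav⟩ := hext m
  refine ⟨v', hv', ?_⟩
  rw [List.append_assoc]
  exact Avoids.append_append (by omega) (huv.of_infix (List.prefix_append _ _).isInfix) hav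

/-! ### Weights of allowed words -/

section

variable [DecidableEq α]

theorem weight_eq_zero {W : Collections α ℓ s} (hne : ∀ i, W.word i ≠ []) {w : List α}
    (h : ¬ W.Avoids w) : W.weight w = 0 := by
  simp only [Avoids, not_forall, not_not] at h
  obtain ⟨j, hj⟩ := h
  refine Finset.prod_eq_zero (Finset.mem_univ (Sum.inr j)) ?_
  have : occurrences w (W.word (Sum.inr j)) ≠ 0 := by
    rw [Ne, occurrences_eq_zero_iff (hne _), not_not]
    exact hj
  exact zero_pow this

theorem weight_of_avoids {W : Collections α ℓ s} (hne : ∀ i, W.word i ≠ []) {w : List α}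
    (h : W.Avoids w) : W.weight w = ∏ i, (W.mult i : ℝ) ^ occurrences w (W.rep i) := by
  rw [weight, Fintype.prod_sum_type]
  have h1 : ∀ j : Fin s, W.factor (Sum.inr j) ^ occurrences w (W.word (Sum.inr j)) = 1 := by
    intro j
    rw [(occurrences_eq_zero_iff (hne (Sum.inr j)) w).2 (h j), pow_zero]
  simp only [h1, Finset.prod_const_one, mul_one]
  rfl

theorem weight_pos {W : Collections α ℓ s} (hne : ∀ i, W.word i ≠ [])
    (hmult : ∀ i, 2 ≤ W.mult i) {w : List α} (h : W.Avoids w) : 0 < W.weight w := by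
  rw [weight_of_avoids hne h]
  refine Finset.prod_pos fun i _ => pow_pos ?_ _
  have := hmult i
  positivity

theorem cast_multiplicity {W : Collections α ℓ s} (hne : ∀ i, W.word i ≠ []) {w : List α}
    (h : W.Allowed w) : (W.multiplicity w : ℝ) = W.weight w := by
  rw [multiplicity, if_pos h, weight_of_avoids hne h.avoids]
  push_cast
  rfl

theorem weight_cons (W : Collections α ℓ s) (a : α) (w : List α) :
    W.weight (a :: w) =
      (∏ i, W.factor i ^ (if W.word i <+: a :: w then 1 else 0)) * W.weight w := by
  rw [weight, weight, ← Finset.prod_mul_distrib]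
  exact Finset.prod_congr rfl fun i _ => by rw [occurrences_cons, pow_add]

theorem weight_concat_le {W : Collections α ℓ s} (hred : W.IsReduced) (hne : ∀ i, W.word i ≠ [])
    (w : List α) (x : α) :
    W.weight (w ++ [x]) ≤ (1 + ∑ i, W.factor i) * W.weight w := by
  rw [weight_concat hred hne, add_mul, one_mul, Finset.sum_mul]
  refine add_le_add le_rfl (Finset.sum_le_sum fun i _ => ?_)
  have h1 := W.factor_nonneg i
  have h2 := W.weight_nonneg w
  split_ifs
  · nlinarith
  · nlinarith

theorem weight_append_le {W : Collections α ℓ s} (hred : W.IsReduced) (hne : ∀ i, W.word i ≠ [])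
    (w v : List α) :
    W.weight (w ++ v) ≤ (1 + ∑ i, W.factor i) ^ v.length * W.weight w := by
  induction v using List.reverseRecOn with
  | nil => simp
  | append_singleton v x ih =>
    have h0 : 0 ≤ 1 + ∑ i, W.factor i :=
      add_nonneg zero_le_one (Finset.sum_nonneg fun i _ => W.factor_nonneg i)
    rw [← List.append_assoc, List.length_append, List.length_singleton, pow_succ', mul_assoc]
    exact (weight_concat_le hred hne _ x).trans (mul_le_mul_of_nonneg_left ih h0)

/-- The ratio `k(v)` computes the weight of a longer word with prefix `v`. -/
theorem ratio_mul_weight {W : Collections α ℓ s} (hne : ∀ i, W.word i ≠ [])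
    (hmult : ∀ i, 2 ≤ W.mult i) {a : α} {w : List α} (hp : 0 < W.maxLength)
    (h : W.Allowed (a :: w)) :
    W.ratio ((a :: w).take W.maxLength) * W.weight w = W.weight (a :: w) := by
  have h1 : W.Allowed ((a :: w).take W.maxLength) := h.of_infix (List.take_prefix _ _).isInfix
  obtain ⟨p, hp'⟩ := Nat.exists_eq_succ_of_ne_zero hp.ne'
  have htake : (a :: w).take W.maxLength = a :: w.take p := by rw [hp', List.take_succ_cons]
  rw [ratio, cast_multiplicity hne h1, weight_cons]
  have h2 : W.Allowed (w.take p) := h1.of_infix (htake ▸ (List.suffix_cons _ _).isInfix)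
  -- An occurrence starting at the new first symbol fits into the first p symbols, so truncation
  -- does not change the factor contributed by a.
  have h3 : ∀ i, (W.word i <+: a :: w ↔ W.word i <+: (a :: w).take W.maxLength) := by
    intro i
    rw [List.prefix_take_iff, and_iff_left (W.length_word_le i)]
  simp only [h3]
  rw [htake, List.tail_cons, cast_multiplicity hne h2, weight_cons, mul_div_assoc,
    div_self (weight_pos hne hmult h2.avoids).ne', mul_one]

end

end Collections
end RepeatedWords

/-! ### Powers of a nonnegative matrix with a positive eigenvector -/

namespace Matrix

open Polynomial

variable {ι : Type*} [Fintype ι]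

theorem mulVec_le_mulVec {A : Matrix ι ι ℝ} (hA : ∀ i j, 0 ≤ A i j) {x y : ι → ℝ}
    (h : ∀ i, x i ≤ y i) (i : ι) : (A *ᵥ x) i ≤ (A *ᵥ y) i :=
  Finset.sum_le_sum fun j _ => mul_le_mul_of_nonneg_left (h j) (hA i j)

theorem exists_le_mul_of_pos {v : ι → ℝ} (hv : ∀ i, 0 < v i) (m : ι → ℝ) :
    ∃ C : ℝ, 0 < C ∧ ∀ i, m i ≤ C * v i := by
  have h : ∀ i ∈ Finset.univ, 0 ≤ |m i| / v i := fun i _ => div_nonneg (abs_nonneg _) (hv i).le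
  refine ⟨1 + ∑ i, |m i| / v i, add_pos_of_pos_of_nonneg one_pos (Finset.sum_nonneg h),
    fun i => ?_⟩
  rw [← div_le_iff₀ (hv i)]
  calc m i / v i ≤ |m i| / v i := by gcongr; exacts [(hv i).le, le_abs_self _]
    _ ≤ ∑ i, |m i| / v i := Finset.single_le_sum h (Finset.mem_univ i)
    _ ≤ _ := by linarith

variable [DecidableEq ι]

theorem pow_mulVec_eigenvector {A : Matrix ι ι ℝ} {θ : ℝ} {v : ι → ℝ} (h : A *ᵥ v = θ • v)
    (n : ℕ) : A ^ n *ᵥ v = θ ^ n • v := by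
  induction n with
  | zero => simp
  | succ k ih => rw [pow_succ, ← mulVec_mulVec, h, mulVec_smul, ih, smul_smul, pow_succ']

/-- Each of the positive vectors m and v is bounded by a multiple of the other, and nonnegative
powers of A preserve these inequalities while acting on v by θ ^ n. -/
theorem exists_pow_mulVec_bounds {A : Matrix ι ι ℝ} (hA : ∀ i j, 0 ≤ A i j) {θ : ℝ}
    {v m : ι → ℝ} (hv : ∀ i, 0 < v i) (hm : ∀ i, 0 < m i) (h : A *ᵥ v = θ • v) :
    ∃ c C : ℝ, 0 < c ∧ 0 < C ∧ ∀ n i,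
      c * (θ ^ n * v i) ≤ (A ^ n *ᵥ m) i ∧ (A ^ n *ᵥ m) i ≤ C * (θ ^ n * v i) := by
  obtain ⟨C, hC, hCm⟩ := exists_le_mul_of_pos hv m
  obtain ⟨c, hc, hcm⟩ := exists_le_mul_of_pos hm v
  refine ⟨c⁻¹, C, inv_pos.2 hc, hC, fun n i => ⟨?_, ?_⟩⟩
  · have h1 := mulVec_le_mulVec (pow_apply_nonneg hA n) (x := v) (y := c • m) hcm i
    rw [pow_mulVec_eigenvector h, mulVec_smul] at h1
    rw [inv_mul_le_iff₀ hc]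
    exact h1
  · have h1 := mulVec_le_mulVec (pow_apply_nonneg hA n) (x := m) (y := C • v) hCm i
    rw [mulVec_smul, pow_mulVec_eigenvector h] at h1
    exact h1

/-- The polynomial `z · 1ᵀ adj(z - A) m`. -/
noncomputable def resolventPoly (A : Matrix ι ι ℝ) (m : ι → ℝ) : ℝ[X] :=
  X * ∑ i, ∑ j, (charmatrix A).adjugate i j * C (m j)

/-- The generating function of `1ᵀ Aⁿ m` is a rational function with denominator the
characteristic polynomial. -/
theorem charpoly_mul_tsum {K : Type*} [RCLike K] (A : Matrix ι ι ℝ) (m : ι → ℝ) {z : K}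
    (hz : z ≠ 0) (hs : ∀ i, Summable fun n => ((((A ^ n) *ᵥ m) i : ℝ) : K) * (z⁻¹) ^ n) :
    aeval z A.charpoly * ∑ i, ∑' n, ((((A ^ n) *ᵥ m) i : ℝ) : K) * (z⁻¹) ^ n =
      aeval z (resolventPoly A m) := by
  set y : ι → K := fun i => ∑' n, ((((A ^ n) *ᵥ m) i : ℝ) : K) * (z⁻¹) ^ n with hy
  -- Splitting off the term n = 0 gives (z - A) y = z m; the adjugate of z - A then solves for y.
  have hrec : ∀ i, z * y i - ∑ j, ((A i j : ℝ) : K) * y j = z * ((m i : ℝ) : K) := by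
    intro i
    have h1 := (hs i).tsum_eq_zero_add
    simp only [pow_zero, one_mulVec, mul_one] at h1
    have h2 : HasSum (fun n => ((((A ^ (n + 1)) *ᵥ m) i : ℝ) : K) * (z⁻¹) ^ (n + 1))
        (z⁻¹ * ∑ j, ((A i j : ℝ) : K) * y j) := by
      refine ((hasSum_sum fun j (_ : j ∈ Finset.univ) =>
        (hs j).hasSum.mul_left ((A i j : ℝ) : K)).mul_left z⁻¹).congr_fun fun n => ?_
      rw [pow_succ' A, ← mulVec_mulVec, mulVec, dotProduct, pow_succ']
      push_cast
      rw [Finset.sum_mul, Finset.mul_sum]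
      exact Finset.sum_congr rfl fun j _ => by ring
    rw [h2.tsum_eq] at h1
    have h3 : y i = ((m i : ℝ) : K) + z⁻¹ * ∑ j, ((A i j : ℝ) : K) * y j := h1
    rw [h3, mul_add, mul_inv_cancel_left₀ hz, add_sub_cancel_right]
  set M : Matrix ι ι K := (aeval (R := ℝ) z).mapMatrix (charmatrix A) with hM
  have hMy : M *ᵥ y = fun i => z * ((m i : ℝ) : K) := by
    funext i
    rw [← hrec i, hM]
    simp only [mulVec, dotProduct, AlgHom.mapMatrix_apply, map_apply, charmatrix_apply, map_sub,
      sub_mul, Finset.sum_sub_distrib, aeval_C]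
    congr 1
    rw [Finset.sum_eq_single i (fun j _ hji => by simp [diagonal_apply_ne _ hji.symm]) (by simp)]
    simp
  have hdet : M.det = aeval z A.charpoly := by
    rw [hM, ← AlgHom.map_det, charpoly]
  have hadj : ∀ i, aeval z A.charpoly * y i =
      ∑ j, aeval z ((charmatrix A).adjugate i j) * (z * ((m j : ℝ) : K)) := by
    intro i
    have h := congrArg (fun v => (M.adjugate *ᵥ v) i) hMy
    simp only [mulVec_mulVec, adjugate_mul, smul_mulVec, one_mulVec, Pi.smul_apply,
      smul_eq_mul] at h
    rw [← hdet, h, hM, ← AlgHom.map_adjugate]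
    rfl
  rw [Finset.mul_sum, resolventPoly, map_mul, aeval_X, map_sum, Finset.mul_sum]
  refine Finset.sum_congr rfl fun i _ => ?_
  rw [hadj, map_sum, Finset.mul_sum]
  refine Finset.sum_congr rfl fun j _ => ?_
  rw [map_mul, aeval_C]
  simp only [RCLike.algebraMap_eq_ofReal]
  ring

end Matrix

namespace RepeatedWords
variable {α : Type*} {ℓ s : ℕ}

namespace Collections

/-! ### The adjacency matrix counts the allowed words -/

section

variable [Fintype α]

theorem sum_words_cons (n : ℕ) (φ : List α → ℝ) :
    ∑ w ∈ words α (n + 1), φ w = ∑ a, ∑ w ∈ words α n, φ (a :: w) := by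
  rw [add_comm, sum_words_add, sum_words_one]
  rfl

open Classical in
theorem sum_language (W : Collections α ℓ s) (n : ℕ) (φ : List α → ℝ) :
    ∑ w : W.language n, φ w.1 = ∑ w ∈ words α n, if W.Allowed w then φ w else 0 := by
  rw [← Finset.sum_filter]
  refine Finset.sum_bij (fun w _ => w.1) ?_ ?_ ?_ (fun _ _ => rfl)
  · intro w _
    exact Finset.mem_filter.2 ⟨mem_words.2 w.2.1, w.2.2⟩
  · intro a _ b _ h
    exact Subtype.ext h
  · intro w hw
    have hw := Finset.mem_filter.1 hw
    exact ⟨⟨w, mem_words.1 hw.1, hw.2⟩, Finset.mem_univ _, rfl⟩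

variable [DecidableEq α]

open Classical in
/-- The total weight of the allowed words of length `n`. -/
noncomputable def allowedWeight (W : Collections α ℓ s) (n : ℕ) : ℝ :=
  ∑ w ∈ words α n, if W.Allowed w then W.weight w else 0

open Classical in
/-- The total weight of the allowed words of length `n` with a given prefix. -/
noncomputable def prefixWeight (W : Collections α ℓ s) (n : ℕ) (u : List α) : ℝ :=
  ∑ w ∈ words α n, if W.Allowed w ∧ u <+: w then W.weight w else 0

theorem cast_count {W : Collections α ℓ s} (hne : ∀ i, W.word i ≠ []) (h0 : W.Allowed [])
    (n : ℕ) : (W.count n : ℝ) = W.allowedWeight n := by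
  rw [count, allowedWeight]
  split_ifs with hn
  · subst hn
    rw [sum_words_zero, if_pos h0, weight_nil, Nat.cast_one]
  · rw [← sum_language, Nat.cast_sum]
    exact Finset.sum_congr rfl fun w _ => cast_multiplicity hne w.2.2

theorem prefixWeight_self (W : Collections α ℓ s) {n : ℕ} (Y : W.language n) :
    W.prefixWeight n Y.1 = W.weight Y.1 := by
  rw [prefixWeight, Finset.sum_eq_single Y.1]
  · rw [if_pos ⟨Y.2.2, List.prefix_rfl⟩]
  · intro w hw hwY
    refine if_neg fun h => hwY (h.2.eq_of_length ?_).symm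
    rw [mem_words.1 hw, Y.2.1]
  · exact fun h => absurd (mem_words.2 Y.2.1) h

theorem sum_prefixWeight (W : Collections α ℓ s) {n k : ℕ} (hk : k ≤ n) :
    ∑ Y : W.language k, W.prefixWeight n Y.1 = W.allowedWeight n := by
  classical
  simp only [prefixWeight]
  rw [Finset.sum_comm, allowedWeight]
  refine Finset.sum_congr rfl fun w hw => ?_
  have hw := mem_words.1 hw
  split_ifs with h
  · have hlen : (w.take k).length = k := by simp [hw, hk]
    rw [Finset.sum_eq_single ⟨w.take k, hlen, h.of_infix (List.take_prefix _ _).isInfix⟩]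
    · rw [if_pos ⟨h, List.take_prefix _ _⟩]
    · intro Y _ hY
      refine if_neg fun h' => hY (Subtype.ext ?_)
      rw [List.prefix_iff_eq_take.1 h'.2, Y.2.1]
    · simp
  · exact Finset.sum_eq_zero fun Y _ => if_neg fun h' => h h'.1

/-- Remove the first symbol a of a word a :: w with prefix Z. The next prefix Y is the first p - 1
symbols of w, and the entry of A at (Z, Y) is the ratio for the first p symbols of a :: w, which is
the whole change of weight. By `Allowed.cons`, those p symbols also decide whether a :: w is
allowed, given that w is. -/
theorem prefixWeight_succ {W : Collections α ℓ s} (hne : ∀ i, W.word i ≠ [])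
    (hmult : ∀ i, 2 ≤ W.mult i) (hp : 2 ≤ W.maxLength) {n : ℕ} (hn : W.maxLength - 1 ≤ n)
    (Z : W.language (W.maxLength - 1)) :
    W.prefixWeight (n + 1) Z.1 = ∑ Y, W.adjMatrix Z Y * W.prefixWeight n Y.1 := by
  classical
  obtain ⟨Z, hZlen, hZ⟩ := Z
  cases Z with
  | nil => simp at hZlen; omega
  | cons a Z =>
    have hZlen' : Z.length + 2 = W.maxLength := by
      simp only [List.length_cons] at hZlen
      omega
    have hL : W.prefixWeight (n + 1) (a :: Z) =
        ∑ w ∈ words α n, if W.Allowed (a :: w) ∧ Z <+: w then W.weight (a :: w) else 0 := by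
      rw [prefixWeight, sum_words_cons, Finset.sum_eq_single a]
      · simp only [List.cons_prefix_cons, true_and]
      · intro b _ hb
        refine Finset.sum_eq_zero fun w _ => if_neg fun h => hb ?_
        exact (List.cons_prefix_cons.1 h.2).1.symm
      · simp
    rw [hL]
    simp only [prefixWeight, Finset.mul_sum]
    rw [Finset.sum_comm]
    refine Finset.sum_congr rfl fun w hw => ?_
    have hw := mem_words.1 hw
    by_cases h : W.Allowed w
    · have hlen : (w.take (W.maxLength - 1)).length = W.maxLength - 1 := by simp [hw, hn]
      rw [Finset.sum_eq_single ⟨w.take (W.maxLength - 1), hlen,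
        h.of_infix (List.take_prefix _ _).isInfix⟩]
      · have hpre : W.Allowed w ∧ w.take (W.maxLength - 1) <+: w := ⟨h, List.take_prefix _ _⟩
        simp only [adjMatrix, Matrix.of_apply, if_pos hpre]
        have hdrop : (w.take (W.maxLength - 1)).dropLast = w.take Z.length := by
          rw [List.dropLast_eq_take, hlen, List.take_take]
          congr 1
          omega
        have hdef : StarDefined (a :: Z) (w.take (W.maxLength - 1)) ↔ Z <+: w := by
          rw [StarDefined, List.tail_cons, hdrop, ← List.prefix_iff_eq_take]
        by_cases hZw : Z <+: w
        · have hstar : wordStar (a :: Z) (w.take (W.maxLength - 1)) =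
              (a :: w).take W.maxLength := by
            have hne' : w.take (W.maxLength - 1) ≠ [] := by
              intro h0
              rw [h0] at hlen
              simp at hlen
              omega
            have hZ' : Z = (w.take (W.maxLength - 1)).dropLast := by
              rw [hdrop]
              exact List.prefix_iff_eq_take.1 hZw
            rw [wordStar, List.getLast?_eq_getLast_of_ne_nil hne', Option.toList_some,
              List.cons_append]
            nth_rewrite 1 [hZ']
            rw [List.dropLast_append_getLast hne',
              show W.maxLength = W.maxLength - 1 + 1 by omega, List.take_succ_cons,
              Nat.add_sub_cancel]
          have hmem : wordStar (a :: Z) (w.take (W.maxLength - 1)) ∈ W.language W.maxLength ↔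
              W.Allowed (a :: w) := by
            rw [hstar]
            constructor
            · intro h'
              exact h.cons (by omega) h'.2
            · intro h'
              refine ⟨?_, h'.of_infix (List.take_prefix _ _).isInfix⟩
              simp only [List.length_take, List.length_cons]
              omega
          simp only [hdef, hmem, hZw, true_and, and_true]
          split_ifs with h'
          · rw [hstar, ratio_mul_weight hne hmult (by omega) h']
          · rw [zero_mul]
        · simp only [hdef, hZw, false_and, and_false, if_false, zero_mul]
      · intro Y _ hY
        rw [if_neg, mul_zero]
        intro h'
        refine hY (Subtype.ext ?_)
        change Y.1 = w.take (W.maxLength - 1)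
        rw [List.prefix_iff_eq_take.1 h'.2, Y.2.1]
      · simp
    · rw [if_neg fun h' => h (h'.1.of_infix (List.suffix_cons a w).isInfix)]
      exact (Finset.sum_eq_zero fun Y _ => by rw [if_neg fun h' => h h'.1, mul_zero]).symm

theorem prefixWeight_eq_pow_mulVec {W : Collections α ℓ s} (hne : ∀ i, W.word i ≠ [])
    (hmult : ∀ i, 2 ≤ W.mult i) (hp : 2 ≤ W.maxLength) (n : ℕ) :
    (fun Y : W.language (W.maxLength - 1) => W.prefixWeight (n + (W.maxLength - 1)) Y.1) =
      (W.adjMatrix ^ n).mulVec fun Y => W.weight Y.1 := by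
  induction n with
  | zero =>
    funext Y
    rw [pow_zero, Matrix.one_mulVec, zero_add, prefixWeight_self]
  | succ n ih =>
    rw [pow_succ', ← Matrix.mulVec_mulVec, ← ih]
    funext Y
    rw [add_right_comm, prefixWeight_succ hne hmult hp (Nat.le_add_left _ _)]
    rfl

theorem allowedWeight_add {W : Collections α ℓ s} (hne : ∀ i, W.word i ≠ [])
    (hmult : ∀ i, 2 ≤ W.mult i) (hp : 2 ≤ W.maxLength) (n : ℕ) :
    W.allowedWeight (n + (W.maxLength - 1)) =
      ∑ Y, (W.adjMatrix ^ n).mulVec (fun Y => W.weight Y.1) Y := by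
  rw [← prefixWeight_eq_pow_mulVec hne hmult hp, sum_prefixWeight W (Nat.le_add_left _ _)]

theorem allowedWeight_nonneg (W : Collections α ℓ s) (n : ℕ) : 0 ≤ W.allowedWeight n :=
  Finset.sum_nonneg fun w _ => by split_ifs; exacts [W.weight_nonneg w, le_rfl]

theorem allowedWeight_le_totalWeight (W : Collections α ℓ s) (n : ℕ) :
    W.allowedWeight n ≤ W.totalWeight n :=
  Finset.sum_le_sum fun w _ => by split_ifs; exacts [le_rfl, W.weight_nonneg w]

/-- An avoiding word of length n + N has an allowed prefix of length n. The remaining N symbols have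
finitely many choices and each multiplies the weight by at most a constant. -/
theorem exists_totalWeight_le {W : Collections α ℓ s} (hred : W.IsReduced)
    (hne : ∀ i, W.word i ≠ []) :
    ∃ (N : ℕ) (K : ℝ), 0 ≤ K ∧ ∀ n, W.maxLength - 1 ≤ n →
      W.totalWeight (n + N) ≤ K * W.allowedWeight n := by
  classical
  obtain ⟨N, hN⟩ := W.exists_extension_bound
  have h0 : 0 ≤ 1 + ∑ i, W.factor i :=
    add_nonneg zero_le_one (Finset.sum_nonneg fun i _ => W.factor_nonneg i)
  refine ⟨N, (words α N).card * (1 + ∑ i, W.factor i) ^ N, by positivity, fun n hn => ?_⟩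
  rw [totalWeight, sum_words_add, allowedWeight, Finset.mul_sum]
  refine Finset.sum_le_sum fun u hu => ?_
  have hu := mem_words.1 hu
  split_ifs with h
  · rw [mul_assoc, ← nsmul_eq_mul, ← Finset.sum_const]
    refine Finset.sum_le_sum fun v hv => ?_
    rw [← mem_words.1 hv]
    exact weight_append_le hred hne u v
  · rw [mul_zero]
    refine (Finset.sum_eq_zero fun v hv => weight_eq_zero hne fun hav => h ?_).le
    exact hN u v (by omega) (mem_words.1 hv) hav

end

open Polynomial

/-! ### Growth of the numbers of words -/

/-- The empty word would be a subword of the word of length at least 2. -/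
theorem word_ne_nil {W : Collections α ℓ s} (hred : W.IsReduced) (hp : 2 ≤ W.maxLength)
    (i : Fin ℓ ⊕ Fin s) : W.word i ≠ [] := by
  intro hi
  obtain ⟨j, _, hj⟩ := (Finset.lt_sup_iff (s := Finset.univ)
    (f := fun i => (W.word i).length)).1 (show 1 < W.maxLength from hp)
  refine hred i j ?_ (hi ▸ List.nil_infix)
  rintro rfl
  simp [hi] at hj

section

variable [Fintype α] [DecidableEq α]

theorem summable_allowedWeight {K : Type*} [RCLike K] {W : Collections α ℓ s} {θ B : ℝ}
    (hθ : 0 < θ) (hB : ∀ n, W.allowedWeight (n + (W.maxLength - 1)) ≤ B * θ ^ n) {z : K}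
    (hz : θ < ‖z‖) : Summable fun n => (W.allowedWeight n : K) * (z⁻¹) ^ n := by
  rw [← summable_nat_add_iff (W.maxLength - 1)]
  have hz0 : 0 < ‖z‖ := hθ.trans hz
  refine Summable.of_norm_bounded (g := fun n => B * (‖z‖⁻¹) ^ (W.maxLength - 1) * (θ / ‖z‖) ^ n)
    ((summable_geometric_of_lt_one (by positivity) ((div_lt_one hz0).2 hz)).mul_left _)
    fun n => ?_
  rw [norm_mul, norm_pow, norm_inv, RCLike.norm_ofReal, abs_of_nonneg (W.allowedWeight_nonneg _)]
  calc _ ≤ B * θ ^ n * ‖z‖⁻¹ ^ (n + (W.maxLength - 1)) :=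
        mul_le_mul_of_nonneg_right (hB n) (by positivity)
    _ = _ := by rw [div_eq_mul_inv, mul_pow, pow_add]; ring

theorem hasGrowth_allowedWeight {W : Collections α ℓ s} {θ b B : ℝ} (hθ : 0 < θ) (hb : 0 < b)
    (hbB : ∀ n, b * θ ^ n ≤ W.allowedWeight (n + (W.maxLength - 1)) ∧
      W.allowedWeight (n + (W.maxLength - 1)) ≤ B * θ ^ n) : HasGrowth W.allowedWeight θ where
  pos := hθ
  nonneg := W.allowedWeight_nonneg
  summable x hx := summable_allowedWeight hθ (fun n => (hbB n).2)
    (hx.trans_le (Real.le_norm_self x))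
  lower := by
    refine ⟨b / θ ^ (W.maxLength - 1), by positivity, W.maxLength - 1, fun n hn => ?_⟩
    obtain ⟨k, rfl⟩ := Nat.exists_eq_add_of_le' hn
    refine le_trans (le_of_eq ?_) (hbB k).1
    rw [pow_add]
    field_simp

theorem HasGrowth.totalWeight {W : Collections α ℓ s} (hred : W.IsReduced)
    (hne : ∀ i, W.word i ≠ []) {θ : ℝ} (h : HasGrowth W.allowedWeight θ) :
    HasGrowth W.totalWeight θ where
  pos := h.pos
  nonneg := W.totalWeight_nonneg
  summable x hx := by
    have hx0 := h.pos.trans hx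
    obtain ⟨N, K, hK, hN⟩ := exists_totalWeight_le hred hne
    rw [← summable_nat_add_iff (W.maxLength - 1 + N)]
    refine Summable.of_nonneg_of_le
      (fun n => mul_nonneg (W.totalWeight_nonneg _) (by positivity)) (fun n => ?_)
      (((summable_nat_add_iff (W.maxLength - 1)).2 (h.summable x hx)).mul_left (K * x⁻¹ ^ N))
    rw [← add_assoc]
    calc _ ≤ K * W.allowedWeight (n + (W.maxLength - 1)) *
          x⁻¹ ^ (n + (W.maxLength - 1) + N) :=
          mul_le_mul_of_nonneg_right (hN _ (Nat.le_add_left _ _)) (by positivity)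
      _ = _ := by rw [pow_add _ _ N]; ring
  lower := by
    obtain ⟨κ, hκ, N, hN⟩ := h.lower
    exact ⟨κ, hκ, N, fun n hn => (hN n hn).trans (W.allowedWeight_le_totalWeight n)⟩

/-! ### The generating function as a rational function -/

/-- A numerator of the generating function of the allowed words. -/
noncomputable def genNum (W : Collections α ℓ s) : ℝ[X] :=
  W.adjMatrix.charpoly * ∑ n ∈ Finset.range (W.maxLength - 1),
    C (W.allowedWeight n) * X ^ (W.maxLength - 1 - n) +
  Matrix.resolventPoly W.adjMatrix fun Y => W.weight Y.1

/-- A denominator of the generating function of the allowed words. -/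
noncomputable def genDenom (W : Collections α ℓ s) : ℝ[X] :=
  W.adjMatrix.charpoly * X ^ (W.maxLength - 1)

theorem genDenom_ne_zero (W : Collections α ℓ s) : W.genDenom ≠ 0 :=
  mul_ne_zero W.adjMatrix.charpoly_monic.ne_zero (pow_ne_zero _ X_ne_zero)

/-- The first p - 1 terms are cleared by X ^ (p - 1), and the rest is a resolvent series of A. The
identity is needed both over ℂ, for the generating function at large modulus, and over ℝ, for the
behaviour at θ. -/
theorem tsum_mul_genDenom {K : Type*} [RCLike K] {W : Collections α ℓ s}
    (hne : ∀ i, W.word i ≠ []) (hmult : ∀ i, 2 ≤ W.mult i) (hp : 2 ≤ W.maxLength) {z : K}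
    (hz : z ≠ 0) (hs : Summable fun n => (W.allowedWeight n : K) * (z⁻¹) ^ n)
    (hs' : ∀ Y, Summable fun n =>
      (((W.adjMatrix ^ n).mulVec (fun Y => W.weight Y.1) Y : ℝ) : K) * (z⁻¹) ^ n) :
    (∑' n, (W.allowedWeight n : K) * (z⁻¹) ^ n) * aeval z W.genDenom = aeval z W.genNum := by
  have h1 := Matrix.charpoly_mul_tsum W.adjMatrix (fun Y => W.weight Y.1) hz hs'
  rw [← Summable.tsum_finsetSum fun Y _ => hs' Y] at h1
  have h2 : ∀ n, (W.allowedWeight (n + (W.maxLength - 1)) : K) * (z⁻¹) ^ (n + (W.maxLength - 1)) =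
      (z⁻¹) ^ (W.maxLength - 1) *
      ∑ Y, (((W.adjMatrix ^ n).mulVec (fun Y => W.weight Y.1) Y : ℝ) : K) * (z⁻¹) ^ n := by
    intro n
    rw [allowedWeight_add hne hmult hp, ← Finset.sum_mul, pow_add]
    push_cast
    ring
  have h3 := hs.sum_add_tsum_nat_add (W.maxLength - 1)
  simp only [h2, tsum_mul_left] at h3
  rw [← h3, genDenom, genNum, map_mul, map_add, map_mul, ← h1, map_sum, map_pow, aeval_X, add_mul]
  congr 1
  · rw [mul_left_comm, Finset.sum_mul]
    congr 1
    refine Finset.sum_congr rfl fun n hn => ?_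
    have hn := Finset.mem_range.1 hn
    rw [map_mul, aeval_C, map_pow, aeval_X, RCLike.algebraMap_eq_ofReal, mul_assoc]
    congr 1
    nth_rewrite 1 [show W.maxLength - 1 = n + (W.maxLength - 1 - n) by omega]
    rw [pow_add, ← mul_assoc, ← mul_pow, inv_mul_cancel₀ hz, one_pow, one_mul]
  · have : (z⁻¹) ^ (W.maxLength - 1) * z ^ (W.maxLength - 1) = 1 := by
      rw [← mul_pow, inv_mul_cancel₀ hz, one_pow]
    linear_combination (aeval z W.adjMatrix.charpoly * ∑' n, ∑ Y,
      (((W.adjMatrix ^ n).mulVec (fun Y => W.weight Y.1) Y : ℝ) : K) * (z⁻¹) ^ n) * this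

/-- The generating function of the allowed words. -/
noncomputable def genFun (W : Collections α ℓ s) : RatFunc ℝ :=
  algebraMap ℝ[X] (RatFunc ℝ) W.genNum / algebraMap ℝ[X] (RatFunc ℝ) W.genDenom

theorem genFun_num_mul (W : Collections α ℓ s) :
    W.genFun.num * W.genDenom = W.genNum * W.genFun.denom :=
  (RatFunc.num_mul_eq_mul_denom_iff W.genDenom_ne_zero).2 rfl

theorem eval_genFun (W : Collections α ℓ s) {z S : ℂ} (hz : aeval z W.genDenom ≠ 0)
    (h : S * aeval z W.genDenom = aeval z W.genNum) :
    W.genFun.eval (algebraMap ℝ ℂ) z = S := by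
  have h1 := congrArg (aeval z) W.genFun_num_mul
  rw [map_mul, map_mul, ← h] at h1
  have h2 : aeval z W.genFun.denom ≠ 0 := fun h0 => hz <| by
    obtain ⟨r, hr⟩ := RatFunc.denom_div_dvd W.genNum W.genDenom
    change W.genDenom = W.genFun.denom * r at hr
    rw [hr, map_mul, h0, zero_mul]
  change aeval z W.genFun.num / aeval z W.genFun.denom = S
  rw [div_eq_iff h2]
  refine mul_right_cancel₀ hz ?_
  rw [h1]
  ring

end

/-! ### Largest real poles and zeros -/

theorem eval_denom_ne_zero_of_num {G : RatFunc ℝ} {x : ℝ} (h : G.num.eval x = 0) :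
    G.denom.eval x ≠ 0 := by
  intro h'
  obtain ⟨a, b, hab⟩ := G.isCoprime_num_denom
  have := congrArg (Polynomial.eval x) hab
  simp [h, h'] at this

/-- A root of the reduced denominator beyond θ would also be a root of the numerator, contradicting
coprimality. -/
theorem isGreatest_realPoles [Fintype α] [DecidableEq α] {W : Collections α ℓ s} {θ : ℝ}
    (h : HasGrowth W.allowedWeight θ)
    (hF : ∀ x, θ < x →
      invSeries W.allowedWeight x * W.genDenom.eval x = W.genNum.eval x) :
    IsGreatest (realPoles W.genFun) θ := by
  have hnum := W.genFun_num_mul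
  obtain ⟨h1, h2⟩ := h.isRoot_and_cancel (a := W.genFun.denom) (b := W.genFun.num)
    W.genDenom_ne_zero fun x hx => by
      have := congrArg (Polynomial.eval x) hnum
      rw [eval_mul, eval_mul, ← hF x hx] at this
      rw [this]
      ring
  refine ⟨h1, fun x hx => not_lt.1 fun hlt => ?_⟩
  exact eval_denom_ne_zero_of_num (h2 x hlt hx) hx

/-- The series of total weights equals z divided by the combination, so the reduced numerator of the
combination plays the role of the denominator, and z times its reduced denominator that of the
numerator. A common root beyond θ > 0 is excluded by coprimality. -/
theorem isGreatest_realZeros [Fintype α] [DecidableEq α] {W : Collections α ℓ s}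
    (hred : W.IsReduced) (hne : ∀ i, W.word i ≠ []) (hmult : ∀ i, 2 ≤ W.mult i) {θ : ℝ}
    (h : HasGrowth W.totalWeight θ) :
    IsGreatest (realZeros (W.combination W.rowSumP)) θ := by
  have hdet := det_polyP_ne_zero hred hne hmult
  set G := W.combination W.rowSumP with hG
  have hnum : G.num * W.polyP.det = W.combPoly * G.denom := by
    refine (RatFunc.num_mul_eq_mul_denom_iff hdet).2 ?_
    rw [eq_div_iff (by simpa using hdet), hG, combination_mul_det hdet]
  obtain ⟨h1, h2⟩ := h.isRoot_and_cancel (a := G.num) (b := X * G.denom) hdet fun x hx => by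
    have h3 := invSeries_mul_combPoly hred hne hmult (h.pos.trans hx) (h.summable x hx)
    have h4 := congrArg (Polynomial.eval x) hnum
    rw [eval_mul, eval_mul] at h4
    rw [h4, eval_mul, eval_X]
    linear_combination (G.denom.eval x) * h3
  refine ⟨h1, fun x hx => not_lt.1 fun hlt => ?_⟩
  have h3 := h2 x hlt hx
  rw [eval_mul, eval_X] at h3
  exact (mul_ne_zero (h.pos.trans hlt).ne' (eval_denom_ne_zero_of_num hx)) h3

end Collections
end RepeatedWords

/-! ### Proof of the theorem -/

open RepeatedWords
theorem mainTheorem7 {α : Type*} [Fintype α] [DecidableEq α] {ℓ s : ℕ}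
    (W : Collections α ℓ s)
    (hq : 2 ≤ Fintype.card α)
    (hforb : ∀ j, 2 ≤ (W.forb j).length)
    (hsymb : ∀ x : α, W.Allowed [x])
    (hrep : ∀ i, W.Allowed (W.rep i))
    (hmult : ∀ i, 2 ≤ W.mult i)
    (hred : W.IsReduced)
    (hp : 2 ≤ W.maxLength)
    (hirr : W.adjMatrix.IsIrreducible) :
    W.combination W.rowSumP = W.combination W.rowSumQ ∧
    ∃ θ : ℝ, IsPerronRoot W.adjMatrix θ ∧
      IsGreatest (realZeros (W.combination W.rowSumP)) θ ∧
      IsGreatest (realZeros (W.combination W.rowSumQ)) θ ∧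
      ∃ F : RatFunc ℝ, IsGeneratingFunction W.count F ∧ IsGreatest (realPoles F) θ := by
  have hPQ := Collections.combination_rowSumP_eq_rowSumQ hmult (W := W)
  have hne := Collections.word_ne_nil hred hp
  obtain ⟨a⟩ : Nonempty α := Fintype.card_pos_iff.1 (by omega)
  obtain ⟨x, hx, -⟩ := hsymb a
  have hnil : W.Allowed [] := ⟨x, hx, 0, rfl⟩
  have : Nonempty (W.language (W.maxLength - 1)) :=
    ⟨⟨block x 0 (W.maxLength - 1), length_block _ _ _, x, hx, 0, by rw [length_block]⟩⟩
  obtain ⟨θ, v, hθ, hv, hAv, hperron⟩ := hirr.exists_perron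
  obtain ⟨c, C, hc, hC, hbound⟩ := Matrix.exists_pow_mulVec_bounds hirr.nonneg hv
    (m := fun Y => W.weight Y.1) (fun Y => Collections.weight_pos hne hmult Y.2.2.avoids) hAv
  have hV : 0 < ∑ Y, v Y := Finset.sum_pos (fun Y _ => hv Y) Finset.univ_nonempty
  -- Summing the coordinatewise bounds on A ^ n m over all prefixes Y gives two-sided bounds for the
  -- weights of allowed words.
  have hbB : ∀ n, c * (∑ Y, v Y) * θ ^ n ≤ W.allowedWeight (n + (W.maxLength - 1)) ∧
      W.allowedWeight (n + (W.maxLength - 1)) ≤ C * (∑ Y, v Y) * θ ^ n := by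
    intro n
    rw [Collections.allowedWeight_add hne hmult hp, mul_right_comm, mul_right_comm C,
      Finset.mul_sum, Finset.mul_sum]
    simp only [mul_assoc]
    exact ⟨Finset.sum_le_sum fun Y _ => (hbound n Y).1, Finset.sum_le_sum fun Y _ => (hbound n Y).2⟩
  have hgrowth := Collections.hasGrowth_allowedWeight hθ (mul_pos hc hV) hbB
  have hzeros := Collections.isGreatest_realZeros hred hne hmult
    (Collections.HasGrowth.totalWeight hred hne hgrowth)
  have hsum' : ∀ {K : Type} [RCLike K] {z : K}, θ < ‖z‖ → ∀ Y, Summable fun n =>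
      (((W.adjMatrix ^ n).mulVec (fun Y => W.weight Y.1) Y : ℝ) : K) * (z⁻¹) ^ n := by
    intro K _ z hz Y
    have hz0 : 0 < ‖z‖ := hθ.trans hz
    refine Summable.of_norm_bounded (g := fun n => C * v Y * (θ / ‖z‖) ^ n)
      ((summable_geometric_of_lt_one (by positivity) ((div_lt_one hz0).2 hz)).mul_left _)
      fun n => ?_
    have h0 : 0 ≤ (W.adjMatrix ^ n).mulVec (fun Y => W.weight Y.1) Y :=
      le_trans (mul_nonneg hc.le (mul_nonneg (pow_pos hθ n).le (hv Y).le)) (hbound n Y).1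
    rw [norm_mul, norm_pow, norm_inv, RCLike.norm_ofReal, abs_of_nonneg h0]
    calc _ ≤ C * (θ ^ n * v Y) * ‖z‖⁻¹ ^ n :=
          mul_le_mul_of_nonneg_right (hbound n Y).2 (by positivity)
      _ = _ := by rw [div_eq_mul_inv, mul_pow]; ring
  refine ⟨hPQ, θ, hperron, hzeros, hPQ ▸ hzeros, W.genFun, ?_, ?_⟩
  · have hroots : ∀ᶠ z : ℂ in Bornology.cobounded ℂ, Polynomial.aeval z W.genDenom ≠ 0 := by
      have h := Bornology.isBounded_def.1 (W.genDenom.rootSet_finite ℂ).isBounded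
      filter_upwards [h] with z hz h0
      exact hz (Polynomial.mem_rootSet.2 ⟨W.genDenom_ne_zero, h0⟩)
    filter_upwards [hroots, tendsto_norm_cobounded_atTop.eventually_gt_atTop θ] with z hz0 hz
    have hs := Collections.summable_allowedWeight hθ (fun n => (hbB n).2) hz
    have h := Collections.tsum_mul_genDenom hne hmult hp (norm_pos_iff.1 (hθ.trans hz)) hs
      (hsum' hz)
    rw [W.eval_genFun hz0 h]
    have hcount : ∀ n, (W.count n : ℂ) = ((W.allowedWeight n : ℝ) : ℂ) := fun n => by
      rw [← Collections.cast_count hne hnil, Complex.ofReal_natCast]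
    simp only [hcount]
    exact hs.hasSum
  · refine Collections.isGreatest_realPoles hgrowth fun x hx => ?_
    have h := Collections.tsum_mul_genDenom (K := ℝ) hne hmult hp (hθ.trans hx).ne'
      (hgrowth.summable x hx) (hsum' (hx.trans_le (Real.le_norm_self x)))
    simp only [Polynomial.coe_aeval_eq_eval] at h
    exact h
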